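/- Let $M$ be a smooth manifold of dimension $n\ge 4$. For $t\in\mathbb R$ let $L^t_M$ be the line bundle of densities of weight $t$, whose fibre at $x$ consists of the maps $l:\Lambda^nT_xM\setminus 0\to\mathbb R$ with $l(\lambda w)=|\lambda|^{-t/n}l(w)$ for $\lambda\ne0$; a Riemannian metric $g$ determines the section $l_g^t$ of $L^t_M$ that equals $1$ on elements of $g$-length one. A conformal structure on $M$ is a section $c$ of $S^2T^*M\otimes L^2_M$ of the form $c=g\otimes l_g^2$ for some smooth Riemannian metric $g$; the metrics $g$ with $c=g\otimes l_g^2$ are the metrics in the conformal class $c$. Let $J$ be an almost-complex structure on $M$ that is orthogonal for the metrics in the class, so that $(M,c,J)$ is a conformal almost-Hermitian manifold. We say that $J$ is integrable if its torsion (Nijenhuis tensor) $[JX,JY]-J[JX,Y]-J[X,JY]-[X,Y]$ vanishes. For a metric $g$ in $c$ put $\Omega_g(X,Y)=g(JX,Y)$. The Lee form $\omega_g$ and the $3$-form $(d\Omega_g)_0$ are defined by $d\Omega_g=\omega_g\wedge\Omega_g+(d\Omega_g)_0$, where $(d\Omega_g)_0$ is pointwise $g$-orthogonal to all $\theta\wedge\Omega_g$,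 $\theta\in T^*M$. The connection $\nabla$ on $L^t_M$ given by $\nabla_Xl_g^t=-\tfrac t2\,\omega_g(X)\,l_g^t$ does not depend on the choice of $g$ in $c$. The canonical Weyl connection $\nabla$ on $TM$ is the torsion-free connection preserving $c$ that is determined by the connection on $L^2_M$ through $$2c(\nabla_XY,Z)=\nabla_Xc(Y,Z)+\nabla_Yc(X,Z)-\nabla_Zc(X,Y)+c([X,Y],Z)-c([X,Z],Y)-c([Y,Z],X).$$ Let $\Omega(X,Y)=c(JX,Y)$ be the $L^2_M$-valued fundamental form, and $d^\nabla$ the exterior covariant derivative on $L^2_M$-valued forms. Then: 1. For every metric $g$ in $c$: $\nabla J=0$ if and only if $J$ is integrable and $(d\Omega_g)_0=0$. 2. For every metric $g$ in $c$, the curvature $R^\nabla(X,Y)=\nabla_{[X,Y]}-[\nabla_X,\nabla_Y]$ of $\nabla$ on $L^2_M$ satisfies $R^\nabla l_g^2=d\omega_g\otimes l_g^2$, with the normalization $d\omega(X,Y)=X\omega(Y)-Y\omega(X)-\omega([X,Y])$. 3. Suppose that $J$ is integrable. Then $(M,c,J)$ is locally conformal Kähler (that is, for some metric $g$ in $c$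 every point has an open neighbourhood $U$ with a smooth function $\alpha$ on $U$ such that $e^{\alpha}g|_U$ is a Kähler metric for $J$) if and only if the connection $\nabla$ on $L^2_M$ is flat and $d^\nabla\Omega=0$. -/

import Mathlib

open scoped Manifold ContDiff Topology

noncomputable section

namespace LCK

/-! ### Densities on a vector space -/

section Densities

variable {V : Type*} [AddCommGroup V] [Module ℝ V]

/-- Densities of weight `t` on an `n`-dimensional space `V`: functions `l` on `Λⁿ V ∖ 0` with
`l (a w) = |a| ^ (-t / n) * l w`. Such a function is extended to all of `Λⁿ V` by `l 0 = 0`. -/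
def Density (t : ℝ) (V : Type*) [AddCommGroup V] [Module ℝ V] :
    Submodule ℝ (⋀[ℝ]^(Module.finrank ℝ V) V → ℝ) where
  carrier := {l | l 0 = 0 ∧ ∀ (a : ℝ) (w : ⋀[ℝ]^(Module.finrank ℝ V) V), a ≠ 0 → w ≠ 0 →
    l (a • w) = |a| ^ (-t / (Module.finrank ℝ V : ℝ)) * l w}
  zero_mem' := ⟨rfl, fun _ _ _ _ ↦ by simp⟩
  add_mem' := by
    rintro l l' ⟨h0, h⟩ ⟨h0', h'⟩
    refine ⟨by simp [h0, h0'], fun a w ha hw ↦ ?_⟩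
    simp only [Pi.add_apply, h a w ha hw, h' a w ha hw]
    ring
  smul_mem' := by
    rintro r l ⟨h0, h⟩
    refine ⟨by simp [h0], fun a w ha hw ↦ ?_⟩
    simp only [Pi.smul_apply, smul_eq_mul, h a w ha hw]
    ring

/-- The squared length on `Λⁿ V` induced by a bilinear form `b` on `V`; on `v₁ ∧ … ∧ vₙ` it is the
Gram determinant `det (b (vᵢ, vⱼ))`. -/
def lengthSq (b : V →ₗ[ℝ] V →ₗ[ℝ] ℝ) (w : ⋀[ℝ]^(Module.finrank ℝ V) V) : ℝ :=
  exteriorPower.pairingDual ℝ V (Module.finrank ℝ V)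
    (exteriorPower.map (Module.finrank ℝ V) (b : V →ₗ[ℝ] Module.Dual ℝ V) w) w

open Classical in
/-- The density `l_b^t` of a Euclidean metric `b`: it takes the value `1` on the elements of
length one of `Λⁿ V`, that is, `l_b^t (w) = |w| ^ (-t / n)`. -/
def metricDensity (t : ℝ) (b : V →ₗ[ℝ] V →ₗ[ℝ] ℝ) : Density t V :=
  ⟨fun w ↦ if w = 0 then 0 else
      (Real.sqrt (lengthSq b w)) ^ (-t / (Module.finrank ℝ V : ℝ)), by
    refine ⟨by simp, fun a w ha hw ↦ ?_⟩
    have h : lengthSq b (a • w) = a ^ 2 * lengthSq b w := by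
      simp only [lengthSq, map_smul, LinearMap.smul_apply, smul_eq_mul]
      ring
    have haw : a • w ≠ 0 := smul_ne_zero ha hw
    simp only [haw, hw, if_false]
    rw [h, Real.sqrt_mul (sq_nonneg a), Real.sqrt_sq_eq_abs,
      Real.mul_rpow (abs_nonneg a) (Real.sqrt_nonneg _)]⟩

/-- The coordinate of a density `s` with respect to a non-zero density `l` of the same weight:
the real number `a` with `s = a • l`. -/
def Density.coord {t : ℝ} (l s : Density t V) : ℝ :=
  Classical.epsilon fun a : ℝ ↦ s = a • l

/-- The wedge product `η ∧ Ω` of a covector and an alternating `2`-form: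
`(η ∧ Ω) (u, v, w) = η u * Ω (v, w) - η v * Ω (u, w) + η w * Ω (u, v)`. -/
def wedge (η : V →ₗ[ℝ] ℝ) (Ω : V [⋀^Fin 2]→ₗ[ℝ] ℝ) : V [⋀^Fin 3]→ₗ[ℝ] ℝ :=
  AlternatingMap.alternatizeUncurryFin (η.smulRight Ω)

/-- Two `3`-forms are orthogonal for the inner product on `Λ³ V*` induced by the Euclidean
metric `b`, computed in orthonormal bases. -/
def FormOrthogonal (b : V →ₗ[ℝ] V →ₗ[ℝ] ℝ) (φ ψ : V [⋀^Fin 3]→ₗ[ℝ] ℝ) : Prop :=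
  ∀ e : Module.Basis (Fin (Module.finrank ℝ V)) ℝ V,
    (∀ i j, b (e i) (e j) = if i = j then 1 else 0) →
      ∑ i, ∑ j, ∑ k, φ ![e i, e j, e k] * ψ ![e i, e j, e k] = 0

end Densities

/-! ### Vector fields, differential forms, densities on a manifold -/

section Manifolds

variable {E : Type*} [NormedAddCommGroup E] [NormedSpace ℝ E]
  {M : Type*} [TopologicalSpace M] [ChartedSpace E M]

/-- The tangent space `T_x M`. -/
abbrev Tan (E : Type*) [NormedAddCommGroup E] [NormedSpace ℝ E]
    {M : Type*} [TopologicalSpace M] [ChartedSpace E M] (x : M) : Type _ :=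
  TangentSpace 𝓘(ℝ, E) x

/-- Differential forms of degree `k` (no regularity required). -/
abbrev Form (E : Type*) [NormedAddCommGroup E] [NormedSpace ℝ E]
    (M : Type*) [TopologicalSpace M] [ChartedSpace E M] (k : ℕ) : Type _ :=
  (x : M) → Tan E x [⋀^Fin k]→L[ℝ] ℝ

/-- The exterior derivative, computed at `x` in the chart around `x`. The normalization is
`dη (X, Y) = X (η Y) - Y (η X) - η [X, Y]`, matching that of `wedge`. -/
def extD {k : ℕ} (η : Form E M k) : Form E M (k + 1) := fun x ↦
  (extDeriv (fun y : E ↦ ((η ((extChartAt 𝓘(ℝ, E) x).symm y)).compContinuousLinearMap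
      (mfderiv 𝓘(ℝ, E) 𝓘(ℝ, E) (extChartAt 𝓘(ℝ, E) x).symm y) : E [⋀^Fin k]→L[ℝ] ℝ))
    (extChartAt 𝓘(ℝ, E) x x)).compContinuousLinearMap
      (mfderiv 𝓘(ℝ, E) 𝓘(ℝ, E) (extChartAt 𝓘(ℝ, E) x) x)

variable [IsManifold 𝓘(ℝ, E) ∞ M]

/-- Smooth vector fields. -/
def SmoothField (X : (x : M) → Tan E x) : Prop :=
  ContMDiff 𝓘(ℝ, E) 𝓘(ℝ, E).tangent ∞ (fun x ↦ (⟨x, X x⟩ : TangentBundle 𝓘(ℝ, E) M))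

/-- The Lie bracket of vector fields. -/
abbrev bracket (X Y : (x : M) → Tan E x) : (x : M) → Tan E x :=
  VectorField.mlieBracket 𝓘(ℝ, E) X Y

/-- Smooth Riemannian metrics on `M`. -/
abbrev Metric (E : Type*) [NormedAddCommGroup E] [NormedSpace ℝ E]
    (M : Type*) [TopologicalSpace M] [ChartedSpace E M] [IsManifold 𝓘(ℝ, E) ∞ M] : Type _ :=
  Bundle.ContMDiffRiemannianMetric 𝓘(ℝ, E) ∞ E (fun x : M ↦ TangentSpace 𝓘(ℝ, E) x)

/-- The metric `g` at `x` as a bilinear form. -/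
def Metric.bilin (g : Metric E M) (x : M) : Tan E x →ₗ[ℝ] Tan E x →ₗ[ℝ] ℝ :=
  (g.inner x).toLinearMap₁₂

/-- The section `l_g^t` of the density bundle `L^t_M` determined by a Riemannian metric. -/
def Metric.density (g : Metric E M) (t : ℝ) (x : M) : Density t (Tan E x) :=
  metricDensity t (g.bilin x)

/-- A section of `L^t_M` is smooth if its values on smooth local frames of `Λⁿ TM` are smooth. -/
def SmoothDensity {t : ℝ} (s : (x : M) → Density t (Tan E x)) : Prop :=
  ∀ X : (i : Fin (Module.finrank ℝ E)) → (x : M) → Tan E x, (∀ i, SmoothField (X i)) →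
    ∀ x₀ : M, LinearIndependent ℝ (fun i ↦ X i x₀) →
      ContMDiffAt 𝓘(ℝ, E) 𝓘(ℝ, ℝ) ∞
        (fun x ↦ (s x : _ → ℝ)
          (exteriorPower.ιMulti ℝ (Module.finrank ℝ (Tan E x)) (fun i ↦ X i x))) x₀

/-- Almost complex structures on `M`. -/
structure AlmostComplex (E : Type*) [NormedAddCommGroup E] [NormedSpace ℝ E]
    (M : Type*) [TopologicalSpace M] [ChartedSpace E M] [IsManifold 𝓘(ℝ, E) ∞ M] where
  toFun (x : M) : Tan E x →L[ℝ] Tan E x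
  sq (x : M) (v : Tan E x) : toFun x (toFun x v) = -v
  contMDiff : ContMDiff 𝓘(ℝ, E) (𝓘(ℝ, E).prod 𝓘(ℝ, E →L[ℝ] E)) ∞
    (fun x ↦ Bundle.TotalSpace.mk' (E →L[ℝ] E)
      (E := fun x : M ↦ TangentSpace 𝓘(ℝ, E) x →L[ℝ] TangentSpace 𝓘(ℝ, E) x) x (toFun x))

/-- The vector field `J X`. -/
def AlmostComplex.app (J : AlmostComplex E M) (X : (x : M) → Tan E x) : (x : M) → Tan E x :=
  fun x ↦ J.toFun x (X x)

/-- The torsion (Nijenhuis tensor) of `J`. -/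
def AlmostComplex.nijenhuis (J : AlmostComplex E M) (X Y : (x : M) → Tan E x) :
    (x : M) → Tan E x :=
  bracket (J.app X) (J.app Y) - J.app (bracket (J.app X) Y) - J.app (bracket X (J.app Y))
    - bracket X Y

/-- `J` is integrable on `U`: its torsion vanishes there. -/
def AlmostComplex.IntegrableOn (J : AlmostComplex E M) (U : Set M) : Prop :=
  ∀ X Y : (x : M) → Tan E x, SmoothField X → SmoothField Y → ∀ x ∈ U, J.nijenhuis X Y x = 0

/-- `J` is integrable. -/
def AlmostComplex.Integrable (J : AlmostComplex E M) : Prop := J.IntegrableOn Set.univ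

/-- The field of bilinear forms `h` is, on the open set `U`, a Kähler metric for `J`: there `h` is
smooth, symmetric, positive definite and `J`-invariant, `J` is integrable, and the fundamental
form `h (J ·, ·)` is closed. -/
structure IsKahlerOn (h : (x : M) → Tan E x →L[ℝ] Tan E x →L[ℝ] ℝ) (J : AlmostComplex E M)
    (U : Set M) : Prop where
  isOpen : IsOpen U
  contMDiffOn : ContMDiffOn 𝓘(ℝ, E) (𝓘(ℝ, E).prod 𝓘(ℝ, E →L[ℝ] E →L[ℝ] ℝ)) ∞
    (fun x ↦ Bundle.TotalSpace.mk' (E →L[ℝ] E →L[ℝ] ℝ)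
      (E := fun x : M ↦ TangentSpace 𝓘(ℝ, E) x →L[ℝ] TangentSpace 𝓘(ℝ, E) x →L[ℝ] ℝ) x (h x)) U
  symm : ∀ x ∈ U, ∀ u v, h x u v = h x v u
  pos : ∀ x ∈ U, ∀ u, u ≠ 0 → 0 < h x u u
  hermitian : ∀ x ∈ U, ∀ u v, h x (J.toFun x u) (J.toFun x v) = h x u v
  integrable : J.IntegrableOn U
  closed : ∃ Ω : Form E M 2, (∀ x ∈ U, ∀ u v, Ω x ![u, v] = h x (J.toFun x u) v) ∧
    ∀ x ∈ U, extD Ω x = 0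

/-- The metric `g` is locally conformal Kähler with respect to `J`: around every point there is a
smooth function `α` such that `e^α g` is a Kähler metric. -/
def Metric.IsLocallyConformalKahler (g : Metric E M) (J : AlmostComplex E M) : Prop :=
  ∀ x₀ : M, ∃ U : Set M, x₀ ∈ U ∧ ∃ α : M → ℝ, ContMDiffOn 𝓘(ℝ, E) 𝓘(ℝ, ℝ) ∞ α U ∧
    IsKahlerOn (fun x ↦ Real.exp (α x) • g.inner x) J U

/-! ### Conformal almost-Hermitian manifolds -/

/-- A conformal structure: a section `c` of `S² T*M ⊗ L²_M` of the form `g ⊗ l_g²` for some smooth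
Riemannian metric `g`. -/
structure Conformal (E : Type*) [NormedAddCommGroup E] [NormedSpace ℝ E]
    (M : Type*) [TopologicalSpace M] [ChartedSpace E M] [IsManifold 𝓘(ℝ, E) ∞ M] where
  toFun (x : M) : Tan E x →ₗ[ℝ] Tan E x →ₗ[ℝ] Density 2 (Tan E x)
  exists_metric : ∃ g : Metric E M, ∀ x u v, toFun x u v = g.inner x u v • g.density 2 x

/-- The metric `g` belongs to the conformal class `c`, that is, `c = g ⊗ l_g²`. -/
def Conformal.Contains (c : Conformal E M) (g : Metric E M) : Prop :=
  ∀ x u v, c.toFun x u v = g.inner x u v • g.density 2 x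

/-- A conformal almost-Hermitian structure `(c, J)` on `M`. -/
structure ConfAlmostHermitian (E : Type*) [NormedAddCommGroup E] [NormedSpace ℝ E]
    (M : Type*) [TopologicalSpace M] [ChartedSpace E M] [IsManifold 𝓘(ℝ, E) ∞ M] where
  c : Conformal E M
  J : AlmostComplex E M
  compatible : ∀ g : Metric E M, c.Contains g →
    ∀ x u v, g.inner x (J.toFun x u) (J.toFun x v) = g.inner x u v

namespace ConfAlmostHermitian

/-- The Riemannian metrics in the conformal class. -/
abbrev Gauge (S : ConfAlmostHermitian E M) : Type _ := {g : Metric E M // S.c.Contains g}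

/-- A metric in the conformal class, used to write down the connection on the density bundles;
that connection does not depend on this choice. -/
def gauge (S : ConfAlmostHermitian E M) : S.Gauge :=
  ⟨S.c.exists_metric.choose, S.c.exists_metric.choose_spec⟩

/-- The fundamental form `Ω_g (X, Y) = g (J X, Y)`. -/
def fundForm (S : ConfAlmostHermitian E M) (g : S.Gauge) : Form E M 2 := fun x ↦
  { toFun := fun v ↦ g.1.inner x (S.J.toFun x (v 0)) (v 1)
    map_update_add' := by
      intro _ v i a b
      fin_cases i <;> simp [Function.update]
    map_update_smul' := by
      intro _ v i r a
      fin_cases i <;> simp [Function.update]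
    cont := by
      have h : Continuous fun v : Fin 2 → E ↦
          (show E →L[ℝ] E →L[ℝ] ℝ from g.1.inner x)
            ((show E →L[ℝ] E from S.J.toFun x) (v 0)) (v 1) := by fun_prop
      exact h
    map_eq_zero_of_eq' := by
      have key : ∀ u : Tan E x, g.1.inner x (S.J.toFun x u) u = 0 := by
        intro u
        have h := S.compatible g.1 g.2 x (S.J.toFun x u) u
        rw [S.J.sq, map_neg, neg_apply, g.1.symm x u (S.J.toFun x u)] at h
        linarith
      intro v i j hij hne
      have h01 : v 0 = v 1 := by
        fin_cases i <;> fin_cases j <;> simp_all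
      simpa [h01] using key (v 1) }

/-- `η` is the Lee covector at `x`: `η ∧ Ω_g` is the component of `dΩ_g` in the image of
the map `θ ↦ θ ∧ Ω_g`, with respect to the `g`-orthogonal splitting of the `3`-forms. -/
def IsLee (S : ConfAlmostHermitian E M) (g : S.Gauge) (x : M) (η : Tan E x →L[ℝ] ℝ) : Prop :=
  ∀ θ : Tan E x →L[ℝ] ℝ, FormOrthogonal (g.1.bilin x)
    ((extD (S.fundForm g) x).toAlternatingMap -
      wedge η.toLinearMap (S.fundForm g x).toAlternatingMap)
    (wedge θ.toLinearMap (S.fundForm g x).toAlternatingMap)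

/-- The Lee form `ω_g`. -/
def lee (S : ConfAlmostHermitian E M) (g : S.Gauge) (x : M) : Tan E x →L[ℝ] ℝ :=
  Classical.epsilon fun η ↦ S.IsLee g x η

/-- The Lee form as a differential form of degree one. -/
def leeForm (S : ConfAlmostHermitian E M) (g : S.Gauge) : Form E M 1 := fun x ↦
  ContinuousAlternatingMap.ofSubsingleton ℝ (Tan E x) ℝ (0 : Fin 1) (S.lee g x)

/-- The component `(dΩ_g)₀ = dΩ_g - ω_g ∧ Ω_g`. -/
def dFundForm₀ (S : ConfAlmostHermitian E M) (g : S.Gauge) (x : M) :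
    Tan E x [⋀^Fin 3]→ₗ[ℝ] ℝ :=
  (extD (S.fundForm g) x).toAlternatingMap -
    wedge (S.lee g x).toLinearMap (S.fundForm g x).toAlternatingMap

/-- The connection on `L^t_M` given by `∇_X l_g^t = -(t / 2) ω_g (X) l_g^t`, so that
`∇_X (f l_g^t) = (X f - (t / 2) ω_g (X) f) l_g^t`. -/
def nablaL (S : ConfAlmostHermitian E M) {t : ℝ} (X : (x : M) → Tan E x)
    (s : (x : M) → Density t (Tan E x)) : (x : M) → Density t (Tan E x) := fun x ↦
  (mvfderiv 𝓘(ℝ, E) (fun y : M ↦ Density.coord (S.gauge.1.density t y) (s y)) x (X x)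
      - t / 2 * S.lee S.gauge x (X x) * Density.coord (S.gauge.1.density t x) (s x)) •
    S.gauge.1.density t x

/-- The section `c (X, Y)` of `L²_M`. -/
def pair (S : ConfAlmostHermitian E M) (X Y : (x : M) → Tan E x) :
    (x : M) → Density 2 (Tan E x) := fun x ↦ S.c.toFun x (X x) (Y x)

/-- The right hand side of the conformal six-terms formula. -/
def sixTerms (S : ConfAlmostHermitian E M) (X Y Z : (x : M) → Tan E x) :
    (x : M) → Density 2 (Tan E x) :=
  S.nablaL X (S.pair Y Z) + S.nablaL Y (S.pair X Z) - S.nablaL Z (S.pair X Y)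
    + S.pair (bracket X Y) Z - S.pair (bracket X Z) Y - S.pair (bracket Y Z) X

/-- The canonical Weyl connection on `TM`: for smooth `X`, `Y`, the value of `∇_X Y` at `x` is
the vector determined by the conformal six-terms formula
`2 c (∇_X Y, Z) = ∇_X c (Y, Z) + ∇_Y c (X, Z) - ∇_Z c (X, Y) + c ([X, Y], Z) - c ([X, Z], Y)
- c ([Y, Z], X)` for all smooth `Z`. -/
def nabla (S : ConfAlmostHermitian E M) (X Y : (x : M) → Tan E x) : (x : M) → Tan E x := fun x ↦
  Classical.epsilon fun v : Tan E x ↦ ∀ Z : (x : M) → Tan E x, SmoothField Z →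
    (2 : ℝ) • S.c.toFun x v (Z x) = S.sixTerms X Y Z x

/-- `∇` preserves `J`. -/
def PreservesJ (S : ConfAlmostHermitian E M) : Prop :=
  ∀ X Y : (x : M) → Tan E x, SmoothField X → SmoothField Y →
    S.nabla X (S.J.app Y) = S.J.app (S.nabla X Y)

/-- The curvature `R (X, Y) s = ∇_[X, Y] s - (∇_X ∇_Y s - ∇_Y ∇_X s)` of `∇` on `L^t_M`. -/
def curvL (S : ConfAlmostHermitian E M) {t : ℝ} (X Y : (x : M) → Tan E x)
    (s : (x : M) → Density t (Tan E x)) : (x : M) → Density t (Tan E x) :=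
  S.nablaL (bracket X Y) s - (S.nablaL X (S.nablaL Y s) - S.nablaL Y (S.nablaL X s))

/-- The connection `∇` on `L²_M` is flat. -/
def IsFlat (S : ConfAlmostHermitian E M) : Prop :=
  ∀ X Y : (x : M) → Tan E x, SmoothField X → SmoothField Y →
    ∀ s : (x : M) → Density 2 (Tan E x), SmoothDensity s → S.curvL X Y s = 0

/-- The `L²_M`-valued fundamental form `Ω (X, Y) = c (J X, Y)`. -/
def Omega (S : ConfAlmostHermitian E M) (X Y : (x : M) → Tan E x) :
    (x : M) → Density 2 (Tan E x) := S.pair (S.J.app X) Y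

/-- The exterior covariant derivative `d^∇ Ω`, evaluated on vector fields. -/
def dNablaOmega (S : ConfAlmostHermitian E M) (X Y Z : (x : M) → Tan E x) :
    (x : M) → Density 2 (Tan E x) :=
  S.nablaL X (S.Omega Y Z) - S.nablaL Y (S.Omega X Z) + S.nablaL Z (S.Omega X Y)
    - S.Omega (bracket X Y) Z + S.Omega (bracket X Z) Y - S.Omega (bracket Y Z) X

/-- `Ω` is `d^∇`-closed. -/
def OmegaClosed (S : ConfAlmostHermitian E M) : Prop :=
  ∀ X Y Z : (x : M) → Tan E x, SmoothField X → SmoothField Y → SmoothField Z →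
    S.dNablaOmega X Y Z = 0

/-- `(M, c, J)` is locally conformal Kähler: some metric in the conformal class is locally
conformal to Kähler metrics. -/
def IsLocallyConformalKahler (S : ConfAlmostHermitian E M) : Prop :=
  ∃ g : S.Gauge, g.1.IsLocallyConformalKahler S.J

end ConfAlmostHermitian

end Manifolds

end LCK

end

/-! The density `l_g²` of the chosen metric `S.gauge` trivializes `L²_M`. In this trivialization the
connection is the twisted derivative `X f - ω(X) f`, the form `d^∇ Ω` is `dΩ - ω ∧ Ω = (dΩ)₀`
(`twistedDOmega_eq`), and the curvature is multiplication by `dω` (`curvL_smul`). A metric `f g` in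
the class has Lee form `ω + f⁻¹ df` and `(dΩ)₀` scaled by `f` (`lee_eq`, `dFundForm₀_eq`), so `dω`
and the vanishing of `(dΩ)₀` do not depend on the metric.

The Lee form is explicit: contracting a `3`-form `φ` to `∑ φ(u, eᵢ, J eᵢ)` sends `η ∧ Ω` to `(n - 2)
η` and vanishes exactly on the forms orthogonal to all `θ ∧ Ω`. Hence `ω` is the contraction of `dΩ`
divided by `n - 2`. Written with an inverse Gram matrix the contraction makes sense in any smooth
frame, so `ω` is smooth.

For the first claim, the six-terms formula gives `2 g((∇_X J) Y, Z)` as a sum of two Koszul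
expressions. This sum equals `D(X, Y, Z) - D(X, JY, JZ) + g(N(Y, Z), JX)`, where `D = (dΩ)₀` and `N`
is the Nijenhuis tensor (`koszul_add_koszul_app`). If `N` and `D` vanish, so does `∇J`. Conversely,
the cyclic sum of the expression is `2 D` (`cyclic_koszul`), so `∇J = 0` kills `D`, and then the
identity kills `N`.

For the third claim, `d(e^α Ω) = 0` means `dΩ = -dα ∧ Ω`, that is, `ω = -dα` and `(dΩ)₀ = 0`. So a
locally conformal Kähler structure has `dω = 0` and `(dΩ)₀ = 0`. In the other direction the Poincaré
lemma (`exists_mvfderiv_eq`) writes `ω = dβ` locally, and `e^{-β} g` is Kähler. -/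

noncomputable section

namespace LCK

/-! ### Euclidean and Hermitian linear algebra on a single vector space. -/

section LinearAlgebra

variable {V : Type*} [AddCommGroup V] [Module ℝ V]

lemma wedge_apply (η : V →ₗ[ℝ] ℝ) (Ω : V [⋀^Fin 2]→ₗ[ℝ] ℝ) (u v w : V) :
    wedge η Ω ![u, v, w] = η u * Ω ![v, w] - η v * Ω ![u, w] + η w * Ω ![u, v] := by
  have h0 : Fin.removeNth 0 ![u, v, w] = ![v, w] := by
    ext i; fin_cases i <;> rfl
  have h1 : Fin.removeNth 1 ![u, v, w] = ![u, w] := by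
    ext i; fin_cases i <;> rfl
  have h2 : Fin.removeNth 2 ![u, v, w] = ![u, v] := by
    ext i; fin_cases i <;> rfl
  simp [wedge, AlternatingMap.alternatizeUncurryFin_apply, Fin.sum_univ_three, h0, h1, h2]
  ring

lemma alternating_three_ext {φ ψ : V [⋀^Fin 3]→ₗ[ℝ] ℝ}
    (h : ∀ u v w, φ ![u, v, w] = ψ ![u, v, w]) : φ = ψ := by
  ext v
  have : v = ![v 0, v 1, v 2] := by ext i; fin_cases i <;> rfl
  rw [this, h]

lemma alternating_swap01 (φ : V [⋀^Fin 3]→ₗ[ℝ] ℝ) (u v w : V) :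
    φ ![v, u, w] = -φ ![u, v, w] := by
  rw [← φ.map_swap ![u, v, w] (show (0 : Fin 3) ≠ 1 by decide)]
  congr 1; ext i; fin_cases i <;> rfl

lemma alternating_swap12 (φ : V [⋀^Fin 3]→ₗ[ℝ] ℝ) (u v w : V) :
    φ ![u, w, v] = -φ ![u, v, w] := by
  rw [← φ.map_swap ![u, v, w] (show (1 : Fin 3) ≠ 2 by decide)]
  congr 1; ext i; fin_cases i <;> rfl

/-- A `3`-form as an iterated linear map. -/
def trilin (φ : V [⋀^Fin 3]→ₗ[ℝ] ℝ) : V →ₗ[ℝ] V →ₗ[ℝ] V →ₗ[ℝ] ℝ :=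
  LinearMap.mk₂ ℝ (fun u v ↦
      { toFun := fun w ↦ ((φ.curryLeft u).curryLeft v).curryLeft w ![]
        map_add' := fun w w' ↦ by rw [map_add]; rfl
        map_smul' := fun c w ↦ by rw [map_smul]; rfl })
    (fun u u' v ↦ by ext w; simp only [map_add, AlternatingMap.curryLeft_add]; rfl)
    (fun c u v ↦ by ext w; simp only [map_smul, AlternatingMap.curryLeft_smul]; rfl)
    (fun u v v' ↦ by ext w; simp only [map_add, AlternatingMap.curryLeft_add]; rfl)
    (fun c u v ↦ by ext w; simp only [map_smul, AlternatingMap.curryLeft_smul]; rfl)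

lemma trilin_apply (φ : V [⋀^Fin 3]→ₗ[ℝ] ℝ) (u v w : V) : trilin φ u v w = φ ![u, v, w] := rfl

variable (b : V →ₗ[ℝ] V →ₗ[ℝ] ℝ)

/-- A symmetric positive definite bilinear form. -/
structure IsEuclidean : Prop where
  symm : ∀ u v, b u v = b v u
  pos : ∀ u, u ≠ 0 → 0 < b u u

/-- Orthonormality of a basis. -/
def IsON {ι : Type*} [DecidableEq ι] (e : Module.Basis ι ℝ V) : Prop :=
  ∀ i j, b (e i) (e j) = if i = j then 1 else 0

/-- The Gram matrix of a family of vectors. -/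
def gram {ι : Type*} (e : ι → V) : Matrix ι ι ℝ := Matrix.of fun i j ↦ b (e i) (e j)

variable {b}

lemma IsEuclidean.exists_ON [FiniteDimensional ℝ V] (hb : IsEuclidean b) :
    ∃ e : Module.Basis (Fin (Module.finrank ℝ V)) ℝ V, IsON b e := by
  have hsymm : LinearMap.IsSymm (b : LinearMap.BilinForm ℝ V) :=
    ⟨fun u v ↦ by simpa using hb.symm u v⟩
  obtain ⟨v, hv⟩ := LinearMap.BilinForm.exists_orthogonal_basis hsymm
  have hpos : ∀ i, 0 < b (v i) (v i) := fun i ↦ hb.pos _ (v.ne_zero i)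
  have hne : ∀ i, (Real.sqrt (b (v i) (v i)))⁻¹ ≠ 0 := fun i ↦
    inv_ne_zero (Real.sqrt_ne_zero'.2 (hpos i))
  refine ⟨v.unitsSMul fun i ↦ Units.mk0 _ (hne i), fun i j ↦ ?_⟩
  simp only [Module.Basis.unitsSMul_apply, Units.smul_mk0, map_smul, LinearMap.smul_apply,
    smul_eq_mul]
  split_ifs with h
  · subst h
    have := Real.mul_self_sqrt (hpos i).le
    have h2 := Real.sqrt_ne_zero'.2 (hpos i)
    field_simp
    rw [sq, this]
  · have := hv h
    simp only [Function.onFun] at this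
    rw [show b (v i) (v j) = 0 from this]; simp

lemma IsON.repr_eq {ι : Type*} [Fintype ι] [DecidableEq ι] {e : Module.Basis ι ℝ V}
    (he : IsON b e) (u : V) (i : ι) : e.repr u i = b u (e i) := by
  have h := he
  unfold IsON at h
  conv_rhs => rw [← e.sum_repr u]
  simp [h, -Module.Basis.sum_repr]

lemma IsON.sum_repr {ι : Type*} [Fintype ι] [DecidableEq ι] {e : Module.Basis ι ℝ V}
    (he : IsON b e) (u : V) : ∑ i, b u (e i) • e i = u := by
  simp only [← he.repr_eq, e.sum_repr]

section Gram

variable {ι : Type*} [Fintype ι] [DecidableEq ι] {e : Module.Basis ι ℝ V}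

lemma IsON.gram_eq (he : IsON b e) (f : ι → V) :
    gram b f = Matrix.transpose (e.toMatrix f) * e.toMatrix f := by
  have h := he
  unfold IsON at h
  ext i j
  simp only [gram, Matrix.of_apply, Matrix.mul_apply, Matrix.transpose_apply,
    Module.Basis.toMatrix_apply]
  conv_lhs => rw [← e.sum_repr (f i), ← e.sum_repr (f j)]
  simp [h, mul_comm, -Module.Basis.sum_repr]

/-- The metric trace of `B` is independent of the basis: if `P` is the transition matrix, the Gram
matrix is `Pᵀ P`, so `P (Pᵀ P)⁻¹ Pᵀ = 1`. Traces can thus be taken in smooth frames that are not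
orthonormal. -/
lemma IsON.sum_gram_inv (he : IsON b e) (f : Module.Basis ι ℝ V) (B : V →ₗ[ℝ] V →ₗ[ℝ] ℝ) :
    ∑ i, ∑ j, (gram b f)⁻¹ i j * B (f i) (f j) = ∑ i, B (e i) (e i) := by
  set P := e.toMatrix f with hP
  have hdet : IsUnit P.det := by
    rw [← Module.Basis.det_apply]; exact e.isUnit_det f
  have h1 : P * (gram b f)⁻¹ * P.transpose = 1 := by
    rw [he.gram_eq, ← hP, Matrix.mul_inv_rev, ← Matrix.mul_assoc, Matrix.mul_nonsing_inv _ hdet,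
      Matrix.one_mul, Matrix.nonsing_inv_mul]
    rwa [Matrix.det_transpose]
  have h2 : ∀ i j, B (f i) (f j) = ∑ k, ∑ l, P k i * P l j * B (e k) (e l) := by
    intro i j
    conv_lhs => rw [← e.sum_repr (f i), ← e.sum_repr (f j)]
    simp only [map_sum, LinearMap.sum_apply, map_smul, LinearMap.smul_apply, smul_eq_mul, hP,
      Module.Basis.toMatrix_apply, Finset.mul_sum]
    rw [Finset.sum_comm]
    exact Finset.sum_congr rfl fun k _ ↦ Finset.sum_congr rfl fun l _ ↦ by ring
  have h3 : ∀ k l, ∑ i, ∑ j, P k i * (gram b f)⁻¹ i j * P l j = if k = l then 1 else 0 := by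
    intro k l
    rw [← Matrix.one_apply, ← h1, Matrix.mul_apply]
    simp only [Matrix.mul_apply, Matrix.transpose_apply, Finset.sum_mul]
    rw [Finset.sum_comm]
  calc ∑ i, ∑ j, (gram b f)⁻¹ i j * B (f i) (f j)
      = ∑ i, ∑ j, ∑ k, ∑ l, P k i * (gram b f)⁻¹ i j * P l j * B (e k) (e l) := by
        simp only [h2, Finset.mul_sum]
        refine Finset.sum_congr rfl fun i _ ↦ Finset.sum_congr rfl fun j _ ↦
          Finset.sum_congr rfl fun k _ ↦ Finset.sum_congr rfl fun l _ ↦ by ring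
    _ = ∑ k, ∑ l, (∑ i, ∑ j, P k i * (gram b f)⁻¹ i j * P l j) * B (e k) (e l) := by
        simp only [Finset.sum_mul]
        rw [Finset.sum_congr rfl fun i _ ↦ Finset.sum_comm, Finset.sum_comm]
        refine Finset.sum_congr rfl fun k _ ↦ ?_
        rw [Finset.sum_congr rfl fun i _ ↦ Finset.sum_comm, Finset.sum_comm]
    _ = ∑ i, B (e i) (e i) := by simp [h3]

lemma IsON.gram_det_pos (he : IsON b e) (f : ι → V) (hf : LinearIndependent ℝ f)
    (hcard : Fintype.card ι = Module.finrank ℝ V) : 0 < (gram b f).det := by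
  -- Completing an independent family to a basis by counting needs a nonempty index type; the empty
  -- determinant is `1`.
  rcases isEmpty_or_nonempty ι with hι | hι
  · simp
  have hu : IsUnit (e.toMatrix f).det := by
    rw [← coe_basisOfLinearIndependentOfCardEqFinrank hf hcard, ← Module.Basis.det_apply]
    exact e.isUnit_det _
  rw [he.gram_eq, Matrix.det_mul, Matrix.det_transpose]
  exact mul_self_pos.2 hu.ne_zero

lemma IsON.linearIndependent_of_gram_det_ne_zero (he : IsON b e) (f : ι → V)
    (h : (gram b f).det ≠ 0) : LinearIndependent ℝ f := by
  have hu : IsUnit (e.det f) := by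
    rw [he.gram_eq, Matrix.det_mul, Matrix.det_transpose] at h
    rw [Module.Basis.det_apply]
    exact isUnit_iff_ne_zero.2 (left_ne_zero_of_mul h)
  exact ((Module.Basis.is_basis_iff_det e).2 hu).1

end Gram

/-! ### Contraction of three-forms with `J`, and orthogonality to `θ ∧ Ω`. -/

section Contraction

variable (b) in
/-- The contraction `∑ φ (u, eᵢ, J eᵢ)` of a `3`-form, computed in an arbitrary basis. -/
def contraction {ι : Type*} [Fintype ι] [DecidableEq ι] (e : Module.Basis ι ℝ V) (J : V →ₗ[ℝ] V)
    (φ : V [⋀^Fin 3]→ₗ[ℝ] ℝ) (u : V) : ℝ :=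
  ∑ i, ∑ j, (gram b e)⁻¹ i j * φ ![u, e i, J (e j)]

variable {ι : Type*} [Fintype ι] [DecidableEq ι] {e : Module.Basis ι ℝ V} {J : V →ₗ[ℝ] V}

lemma contraction_eq (he : IsON b e) (f : Module.Basis ι ℝ V) (φ : V [⋀^Fin 3]→ₗ[ℝ] ℝ) (u : V) :
    contraction b f J φ u = ∑ i, φ ![u, e i, J (e i)] :=
  he.sum_gram_inv f ((trilin φ u).compl₂ J)

lemma contraction_sub (f : Module.Basis ι ℝ V) (φ ψ : V [⋀^Fin 3]→ₗ[ℝ] ℝ) (u : V) :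
    contraction b f J (φ - ψ) u = contraction b f J φ u - contraction b f J ψ u := by
  simp [contraction, mul_sub, Finset.sum_sub_distrib]

/-- An almost complex structure, orthogonal for `b`, with its fundamental form `Ω`. -/
structure IsHermitianTriple (b : V →ₗ[ℝ] V →ₗ[ℝ] ℝ) (J : V →ₗ[ℝ] V)
    (Ω : V [⋀^Fin 2]→ₗ[ℝ] ℝ) : Prop extends IsEuclidean b where
  sq : ∀ u, J (J u) = -u
  orth : ∀ u v, b (J u) (J v) = b u v
  fund : ∀ u v, Ω ![u, v] = b (J u) v

variable {Ω : V [⋀^Fin 2]→ₗ[ℝ] ℝ}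

/-- The three terms of the wedge contribute `n η(u)`, `-η(u)` and `η(J (J u)) = -η(u)`. -/
lemma contraction_wedge (h : IsHermitianTriple b J Ω) (he : IsON b e) (f : Module.Basis ι ℝ V)
    (η : V →ₗ[ℝ] ℝ) (u : V) :
    contraction b f J (wedge η Ω) u = ((Fintype.card ι : ℝ) - 2) * η u := by
  have h1 : ∑ i, b u (e i) * η (e i) = η u := by
    conv_rhs => rw [← he.sum_repr u]
    simp
  have h2 : ∑ i, η (J (e i)) * b (J u) (e i) = - η u := by
    have : η (J (∑ i, b (J u) (e i) • e i)) = - η u := by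
      rw [he.sum_repr (J u), h.sq, map_neg]
    simpa [mul_comm] using this
  have h3 : ∀ i, b (e i) (e i) = 1 := fun i ↦ by simpa using he i i
  rw [contraction_eq he]
  simp only [wedge_apply, h.fund, h.orth, h3, Finset.sum_add_distrib, Finset.sum_sub_distrib, h2,
    mul_one, Finset.sum_const, Finset.card_univ, nsmul_eq_mul]
  rw [Finset.sum_congr rfl fun i _ ↦ mul_comm (η (e i)) _, h1]
  ring

/-- Expanding `J eⱼ` in the orthonormal basis turns one term of the wedge into a contraction; by
antisymmetry of `φ` the other two contribute the same amount, whence the factor `3`. -/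
lemma sum_mul_wedge (h : IsHermitianTriple b J Ω) (he : IsON b e) (f : Module.Basis ι ℝ V)
    (φ : V [⋀^Fin 3]→ₗ[ℝ] ℝ) (θ : V →ₗ[ℝ] ℝ) :
    ∑ i, ∑ j, ∑ k, φ ![e i, e j, e k] * wedge θ Ω ![e i, e j, e k] =
      3 * ∑ i, θ (e i) * contraction b f J φ (e i) := by
  have h0 : ∀ i j, ∑ k, φ ![e i, e j, e k] * b (J (e j)) (e k) = φ ![e i, e j, J (e j)] := by
    intro i j
    conv_rhs => rw [← trilin_apply, ← he.sum_repr (J (e j))]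
    simp [trilin_apply, mul_comm]
  have h1 : ∑ i, ∑ j, ∑ k, φ ![e i, e j, e k] * (θ (e i) * b (J (e j)) (e k)) =
      ∑ i, θ (e i) * contraction b f J φ (e i) := by
    refine Finset.sum_congr rfl fun i _ ↦ ?_
    rw [contraction_eq he, Finset.mul_sum]
    refine Finset.sum_congr rfl fun j _ ↦ ?_
    rw [← h0, Finset.mul_sum]
    exact Finset.sum_congr rfl fun k _ ↦ by ring
  have h2 : ∑ i, ∑ j, ∑ k, φ ![e i, e j, e k] * (θ (e j) * b (J (e i)) (e k)) =
      - ∑ i, ∑ j, ∑ k, φ ![e i, e j, e k] * (θ (e i) * b (J (e j)) (e k)) := by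
    rw [Finset.sum_comm, ← Finset.sum_neg_distrib]
    refine Finset.sum_congr rfl fun i _ ↦ ?_
    rw [← Finset.sum_neg_distrib]
    refine Finset.sum_congr rfl fun j _ ↦ ?_
    rw [← Finset.sum_neg_distrib]
    refine Finset.sum_congr rfl fun k _ ↦ ?_
    rw [alternating_swap01 φ (e i) (e j)]; ring
  have h3 : ∑ i, ∑ j, ∑ k, φ ![e i, e j, e k] * (θ (e k) * b (J (e i)) (e j)) =
      - ∑ i, ∑ j, ∑ k, φ ![e i, e j, e k] * (θ (e j) * b (J (e i)) (e k)) := by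
    rw [← Finset.sum_neg_distrib]
    refine Finset.sum_congr rfl fun i _ ↦ ?_
    rw [Finset.sum_comm, ← Finset.sum_neg_distrib]
    refine Finset.sum_congr rfl fun j _ ↦ ?_
    rw [← Finset.sum_neg_distrib]
    refine Finset.sum_congr rfl fun k _ ↦ ?_
    rw [alternating_swap12 φ (e i) (e j)]; ring
  simp only [wedge_apply, h.fund, mul_add, mul_sub, Finset.sum_add_distrib,
    Finset.sum_sub_distrib]
  rw [h3, h2, h1]
  ring

end Contraction

section Orthogonality

variable {J : V →ₗ[ℝ] V} {Ω : V [⋀^Fin 2]→ₗ[ℝ] ℝ} [FiniteDimensional ℝ V]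

/-- A `3`-form is orthogonal to all `θ ∧ Ω` if and only if its contraction vanishes. -/
lemma forall_formOrthogonal_wedge_iff (h : IsHermitianTriple b J Ω)
    (f : Module.Basis (Fin (Module.finrank ℝ V)) ℝ V) (φ : V [⋀^Fin 3]→ₗ[ℝ] ℝ) :
    (∀ θ : V →ₗ[ℝ] ℝ, FormOrthogonal b φ (wedge θ Ω)) ↔ ∀ u, contraction b f J φ u = 0 := by
  obtain ⟨e, he⟩ := h.exists_ON
  constructor
  · intro H
    have key : ∀ i, contraction b f J φ (e i) = 0 := by
      intro i
      -- The dual basis covector isolates a single value of the contraction.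
      have := H (e.coord i) e he
      rw [sum_mul_wedge h he f] at this
      simpa [Finsupp.single_apply] using this
    intro u
    rw [contraction_eq he, ← he.sum_repr u]
    have : ∀ i, φ ![∑ j, b u (e j) • e j, e i, J (e i)] =
        ∑ j, b u (e j) * φ ![e j, e i, J (e i)] := by
      intro i
      rw [← trilin_apply]
      simp [trilin_apply]
    rw [Finset.sum_congr rfl fun i _ ↦ this i, Finset.sum_comm]
    refine Finset.sum_eq_zero fun j _ ↦ ?_
    rw [← Finset.mul_sum, ← contraction_eq he f, key, mul_zero]
  · intro H θ e' he'
    rw [sum_mul_wedge h he' f]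
    simp [H]

end Orthogonality

/-! ### The density line of a Euclidean space. -/

section DensityAlgebra

variable [FiniteDimensional ℝ V]

omit [FiniteDimensional ℝ V] in
lemma lengthSq_ιMulti (v : Fin (Module.finrank ℝ V) → V) :
    lengthSq b (exteriorPower.ιMulti ℝ _ v) = (gram b v).det := by
  rw [lengthSq, exteriorPower.map_apply_ιMulti, exteriorPower.pairingDual_ιMulti_ιMulti,
    ← Matrix.det_transpose]
  rfl

omit [FiniteDimensional ℝ V] in
lemma IsON.ιMulti_ne_zero {e : Module.Basis (Fin (Module.finrank ℝ V)) ℝ V} (he : IsON b e) :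
    exteriorPower.ιMulti ℝ _ e ≠ 0 := by
  intro h0
  have h1 := he.gram_det_pos e e.linearIndependent (by simp)
  rw [← lengthSq_ιMulti, h0] at h1
  simp [lengthSq] at h1

omit [FiniteDimensional ℝ V] in
lemma metricDensity_apply (t : ℝ) {w : ⋀[ℝ]^(Module.finrank ℝ V) V} (hw : w ≠ 0) :
    (metricDensity t b : _ → ℝ) w =
      (Real.sqrt (lengthSq b w)) ^ (-t / (Module.finrank ℝ V : ℝ)) := by
  simp [metricDensity, hw]

omit [FiniteDimensional ℝ V] in
lemma metricDensity_ιMulti (t : ℝ) (v : Fin (Module.finrank ℝ V) → V) (hv : 0 < (gram b v).det) :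
    (metricDensity t b : _ → ℝ) (exteriorPower.ιMulti ℝ _ v) =
      (Real.sqrt (gram b v).det) ^ (-t / (Module.finrank ℝ V : ℝ)) := by
  rw [metricDensity_apply, lengthSq_ιMulti]
  intro h0
  rw [← lengthSq_ιMulti, h0] at hv
  simp [lengthSq] at hv

/-- The top exterior power is a line, so by homogeneity a density is determined by its value on one
nonzero element. -/
lemma IsEuclidean.exists_eq_smul (hb : IsEuclidean b) {t : ℝ} (s : Density t V) :
    ∃ a : ℝ, s = a • metricDensity t b := by
  obtain ⟨e, he⟩ := hb.exists_ON
  set w := exteriorPower.ιMulti ℝ (Module.finrank ℝ V) e with hw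
  have hw0 : w ≠ 0 := he.ιMulti_ne_zero
  have h1 : Module.finrank ℝ (⋀[ℝ]^(Module.finrank ℝ V) V) = 1 := by
    rw [exteriorPower.finrank_eq, Nat.choose_self]
  set l := metricDensity t b
  have hl : (l : _ → ℝ) w ≠ 0 := by
    have hp := he.gram_det_pos e e.linearIndependent (by simp)
    rw [metricDensity_ιMulti t _ hp]
    positivity
  refine ⟨(s : _ → ℝ) w / (l : _ → ℝ) w, Subtype.ext (funext fun z ↦ ?_)⟩
  obtain ⟨c, rfl⟩ := exists_smul_eq_of_finrank_eq_one h1 hw0 z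
  -- At `0` homogeneity says nothing; the convention `l 0 = 0` settles that case.
  rcases eq_or_ne c 0 with rfl | hc
  · rw [zero_smul, s.2.1]
    simp [l.2.1]
  · simp only [Submodule.coe_smul, Pi.smul_apply, smul_eq_mul]
    rw [s.2.2 c w hc hw0, l.2.2 c w hc hw0]
    field_simp

lemma IsEuclidean.metricDensity_ne_zero (hb : IsEuclidean b) (t : ℝ) : metricDensity t b ≠ 0 := by
  obtain ⟨e, he⟩ := hb.exists_ON
  have hp := he.gram_det_pos e e.linearIndependent (by simp)
  intro h0
  have := metricDensity_ιMulti t _ hp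
  rw [h0] at this
  have h2 : (0 : ℝ) < (Real.sqrt (gram b e).det) ^ (-t / (Module.finrank ℝ V : ℝ)) := by positivity
  rw [← this] at h2
  simp at h2

omit [FiniteDimensional ℝ V] in
lemma Density.coord_smul {t : ℝ} {l : Density t V} (hl : l ≠ 0) (a : ℝ) :
    Density.coord l (a • l) = a := by
  have : a • l = Density.coord l (a • l) • l :=
    Classical.epsilon_spec (p := fun c : ℝ ↦ a • l = c • l) ⟨a, rfl⟩
  exact (smul_left_injective ℝ hl this).symm

lemma IsEuclidean.eq_coord_smul (hb : IsEuclidean b) {t : ℝ} (s : Density t V) :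
    s = Density.coord (metricDensity t b) s • metricDensity t b :=
  Classical.epsilon_spec (hb.exists_eq_smul s)

end DensityAlgebra

end LinearAlgebra

/-! ### Vector fields in charts, extension of local fields, and brackets. -/

section Calculus

open VectorField

variable {E : Type*} [NormedAddCommGroup E] [NormedSpace ℝ E]
  {M : Type*} [TopologicalSpace M] [ChartedSpace E M]

/-- A vector field written in the chart around `x`. -/
def chartField (x : M) (X : (y : M) → Tan E y) : E → E :=
  mpullback 𝓘(ℝ, E) 𝓘(ℝ, E) (extChartAt 𝓘(ℝ, E) x).symm X

/-- A differential form written in the chart around `x`. -/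
def chartForm {k : ℕ} (x : M) (η : Form E M k) : E → E [⋀^Fin k]→L[ℝ] ℝ := fun y ↦
  (η ((extChartAt 𝓘(ℝ, E) x).symm y)).compContinuousLinearMap
      (mfderiv 𝓘(ℝ, E) 𝓘(ℝ, E) (extChartAt 𝓘(ℝ, E) x).symm y)

variable [IsManifold 𝓘(ℝ, E) ∞ M]

lemma isInvertible_mfderiv_extChartAt_symm {x : M} {y : E}
    (hy : y ∈ (extChartAt 𝓘(ℝ, E) x).target) :
    (mfderiv 𝓘(ℝ, E) 𝓘(ℝ, E) (extChartAt 𝓘(ℝ, E) x).symm y).IsInvertible := by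
  have := isInvertible_mfderivWithin_extChartAt_symm (I := 𝓘(ℝ, E)) hy
  simpa using this

lemma mfderiv_extChartAt_symm_chartField {x : M} {y : E}
    (hy : y ∈ (extChartAt 𝓘(ℝ, E) x).target) (X : (y : M) → Tan E y) :
    mfderiv 𝓘(ℝ, E) 𝓘(ℝ, E) (extChartAt 𝓘(ℝ, E) x).symm y (chartField x X y : E) =
      X ((extChartAt 𝓘(ℝ, E) x).symm y) := by
  obtain ⟨e, he⟩ := isInvertible_mfderiv_extChartAt_symm hy
  have h : chartField x X y = e.symm (X ((extChartAt 𝓘(ℝ, E) x).symm y)) := by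
    rw [chartField, mpullback_apply, ← he, ContinuousLinearMap.inverse_equiv]
    rfl
  rw [h, ← he]
  exact e.apply_symm_apply _

lemma mdifferentiableAt_extChartAt_symm {x : M} {y : E}
    (hy : y ∈ (extChartAt 𝓘(ℝ, E) x).target) :
    MDifferentiableAt 𝓘(ℝ, E) 𝓘(ℝ, E) (extChartAt 𝓘(ℝ, E) x).symm y := by
  have := mdifferentiableWithinAt_extChartAt_symm (I := 𝓘(ℝ, E)) hy
  rwa [modelWithCornersSelf_coe, Set.range_id, mdifferentiableWithinAt_univ] at this

lemma contMDiffAt_extChartAt_symm {x : M} {y : E}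
    (hy : y ∈ (extChartAt 𝓘(ℝ, E) x).target) :
    ContMDiffAt 𝓘(ℝ, E) 𝓘(ℝ, E) ∞ (extChartAt 𝓘(ℝ, E) x).symm y :=
  ((contMDiffOn_extChartAt_symm x) y hy).contMDiffAt
    ((isOpen_extChartAt_target x).mem_nhds hy)

lemma chartForm_chartField {k : ℕ} {x : M} {y : E}
    (hy : y ∈ (extChartAt 𝓘(ℝ, E) x).target) (η : Form E M k)
    (X : Fin k → (y : M) → Tan E y) :
    chartForm x η y (fun i ↦ chartField x (X i) y) =
      η ((extChartAt 𝓘(ℝ, E) x).symm y) (fun i ↦ X i ((extChartAt 𝓘(ℝ, E) x).symm y)) := by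
  refine congrArg (η ((extChartAt 𝓘(ℝ, E) x).symm y)) (funext fun i ↦ ?_)
  exact mfderiv_extChartAt_symm_chartField hy (X i)

lemma fderiv_comp_extChartAt_symm {x : M} {y : E} (hy : y ∈ (extChartAt 𝓘(ℝ, E) x).target)
    {f : M → ℝ} (hf : MDifferentiableAt 𝓘(ℝ, E) 𝓘(ℝ, ℝ) f ((extChartAt 𝓘(ℝ, E) x).symm y))
    (X : (y : M) → Tan E y) :
    fderiv ℝ (f ∘ (extChartAt 𝓘(ℝ, E) x).symm) y (chartField x X y) =
      mvfderiv 𝓘(ℝ, E) f ((extChartAt 𝓘(ℝ, E) x).symm y) (X ((extChartAt 𝓘(ℝ, E) x).symm y)) := by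
  rw [← mfderiv_extChartAt_symm_chartField hy X, ← mfderiv_eq_fderiv]
  exact mvfderiv_comp_apply y hf (mdifferentiableAt_extChartAt_symm hy) _

lemma chartField_extChartAt_self (x : M) (X : (y : M) → Tan E y) :
    chartField x X (extChartAt 𝓘(ℝ, E) x x) = X x := by
  have h1 := mfderivWithin_extChartAt_symm_inverse_apply (I := 𝓘(ℝ, E)) (x := x) (X x)
  -- Every tangent space is the model space `E`, so values at propositionally equal points are
  -- comparable in `E`. This avoids a dependent rewrite.
  have h2 : ∀ z, z = x → (X z : E) = X x := by rintro z rfl; rfl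
  simp only [modelWithCornersSelf_coe, Set.range_id, mfderivWithin_univ] at h1
  refine Eq.trans ?_ h1
  exact congrArg (mfderiv 𝓘(ℝ, E) 𝓘(ℝ, E) (extChartAt 𝓘(ℝ, E) x).symm
    (extChartAt 𝓘(ℝ, E) x x)).inverse (h2 _ (extChartAt_to_inv x))

/-- The manifold bracket is pulled back from the chart at `x`, and the derivative of that chart at
its own centre is the identity. -/
lemma bracket_eq_lieBracket (x : M) (X Y : (y : M) → Tan E y) :
    bracket X Y x = lieBracket ℝ (chartField x X) (chartField x Y) (extChartAt 𝓘(ℝ, E) x x) := by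
  have h := mlieBracketWithin_apply (I := 𝓘(ℝ, E)) (V := X) (W := Y) (s := Set.univ) (x₀ := x)
  rw [mlieBracketWithin_univ] at h
  refine h.trans ?_
  rw [mfderiv_extChartAt_self]
  have hid : (ContinuousLinearMap.id ℝ (TangentSpace 𝓘(ℝ, E) x)).inverse =
    ContinuousLinearMap.id ℝ (TangentSpace 𝓘(ℝ, E) x) := ContinuousLinearMap.inverse_id
  simp only [modelWithCornersSelf_coe, Set.range_id, Set.preimage_univ, Set.inter_univ,
    mpullbackWithin_univ]
  rw [← lieBracketWithin_univ]
  exact congrArg (fun L : TangentSpace 𝓘(ℝ, E) x →L[ℝ] TangentSpace 𝓘(ℝ, E) x ↦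
    L (lieBracketWithin ℝ (chartField x X) (chartField x Y) Set.univ (extChartAt 𝓘(ℝ, E) x x) : E))
      hid

lemma extD_eq_extDeriv {k : ℕ} (x : M) (η : Form E M k) (v : Fin (k + 1) → Tan E x) :
    extD η x v = extDeriv (chartForm x η) (extChartAt 𝓘(ℝ, E) x x) v := by
  simp only [extD]
  rw [mfderiv_extChartAt_self]
  rfl

variable [FiniteDimensional ℝ E]

instance (x : M) : FiniteDimensional ℝ (Tan E x) := inferInstanceAs (FiniteDimensional ℝ E)

lemma contDiffAt_chartField {x : M} {X : (y : M) → Tan E y}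
    (hX : ContMDiffAt 𝓘(ℝ, E) 𝓘(ℝ, E).tangent ∞
      (fun y ↦ (⟨y, X y⟩ : TangentBundle 𝓘(ℝ, E) M)) x) :
    ContDiffAt ℝ ∞ (chartField x X) (extChartAt 𝓘(ℝ, E) x x) := by
  have h := contMDiffWithinAt_mpullbackWithin_extChartAt_symm (n := ∞) (m := ∞)
    (s := Set.univ) (x := x) (V := X) (I := 𝓘(ℝ, E)) hX uniqueMDiffOn_univ (Set.mem_univ _) le_rfl
  have h2 := contMDiffWithinAt_vectorSpace_iff_contDiffWithinAt.1 h
  simp only [Set.preimage_univ, Set.inter_univ, modelWithCornersSelf_coe, Set.range_id,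
    mpullbackWithin_univ] at h2
  exact h2.contDiffAt ((isOpen_extChartAt_target x).mem_nhds (mem_extChartAt_target x))

/-- Multiplying by a bump function supported in `u` globalizes `V`. All the notions above are tested
on global smooth fields, while convenient fields exist only locally. -/
lemma SmoothField.exists_eventuallyEq [T2Space M] {x : M} {V : (y : M) → Tan E y} {u : Set M}
    (hu : u ∈ 𝓝 x) (hV : ContMDiffOn 𝓘(ℝ, E) 𝓘(ℝ, E).tangent ∞
      (fun y ↦ (⟨y, V y⟩ : TangentBundle 𝓘(ℝ, E) M)) u) :
    ∃ X : (y : M) → Tan E y, SmoothField X ∧ ∀ᶠ y in 𝓝 x, X y = V y := by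
  obtain ⟨f, hf⟩ : ∃ f : SmoothBumpFunction 𝓘(ℝ, E) x, tsupport f ⊆ interior u := by
    simpa using (SmoothBumpFunction.nhds_basis_tsupport (I := 𝓘(ℝ, E)) x).mem_iff.1
      (interior_mem_nhds.2 hu)
  refine ⟨(f : M → ℝ) • V, ?_, ?_⟩
  · exact ContMDiffOn.smul_section_of_tsupport (u := interior u) f.contMDiff.contMDiffOn
      isOpen_interior hf (hV.mono interior_subset)
  · filter_upwards [f.eventuallyEq_one] with y hy
    simp [hy]

lemma SmoothField.exists_eq [T2Space M] {x : M} (v : Tan E x) :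
    ∃ X : (y : M) → Tan E y, SmoothField X ∧ X x = v := by
  obtain ⟨s, hs, h⟩ := FiberBundle.exists_contMDiffOn_extend (k := ∞) 𝓘(ℝ, E) E (x₀ := x) v
  obtain ⟨X, hX, hXV⟩ := SmoothField.exists_eventuallyEq hs h
  exact ⟨X, hX, by rw [hXV.self_of_nhds]; simp⟩

/-- Around each point, the constant fields of the chart extend to global smooth fields. -/
lemma SmoothField.exists_chartField_eq [T2Space M] {x x₀ : M}
    (hx : x ∈ (extChartAt 𝓘(ℝ, E) x₀).source) (v : E) :
    ∃ X : (y : M) → Tan E y, SmoothField X ∧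
      ∀ᶠ y in 𝓝 (extChartAt 𝓘(ℝ, E) x₀ x), chartField x₀ X y = v := by
  set φ := extChartAt 𝓘(ℝ, E) x₀ with hφ
  let V : (y : M) → Tan E y := mpullback 𝓘(ℝ, E) 𝓘(ℝ, E) φ (fun _ ↦ v)
  have hV : ContMDiffOn 𝓘(ℝ, E) 𝓘(ℝ, E).tangent ∞
      (fun y ↦ (⟨y, V y⟩ : TangentBundle 𝓘(ℝ, E) M)) φ.source := by
    intro y hy
    refine ContMDiffAt.contMDiffWithinAt ?_
    refine ContMDiffAt.mpullback_vectorField_preimage (n := ∞) (m := ∞) ?_ ?_ ?_ le_rfl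
    · exact contMDiffAt_vectorSpace_iff_contDiffAt.2 contDiffAt_const
    · exact contMDiffAt_extChartAt' (by simpa [hφ] using hy)
    · exact isInvertible_mfderiv_extChartAt hy
  obtain ⟨X, hX, hXV⟩ := SmoothField.exists_eventuallyEq
    ((isOpen_extChartAt_source x₀).mem_nhds hx) hV
  refine ⟨X, hX, ?_⟩
  have hc : ContinuousAt φ.symm (φ x) := continuousAt_extChartAt_symm' hx
  have hev : ∀ᶠ y in 𝓝 (φ x), X (φ.symm y) = V (φ.symm y) := by
    refine Filter.Tendsto.eventually (p := fun z ↦ X z = V z) hc ?_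
    rwa [φ.left_inv hx]
  filter_upwards [hev, (isOpen_extChartAt_target x₀).mem_nhds (φ.map_source hx)] with y hy hyt
  have h1 := mfderivWithin_extChartAt_symm_comp_mfderiv_extChartAt (I := 𝓘(ℝ, E)) hyt
  have h2 := mfderiv_extChartAt_comp_mfderivWithin_extChartAt_symm (I := 𝓘(ℝ, E)) hyt
  simp only [modelWithCornersSelf_coe, Set.range_id, mfderivWithin_univ] at h1 h2
  -- The derivatives of the chart and of its inverse are mutually inverse, so reading `V` back in
  -- the chart returns `v`.
  have h3 : (mfderiv 𝓘(ℝ, E) 𝓘(ℝ, E) φ (φ.symm y)).inverse =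
      mfderiv 𝓘(ℝ, E) 𝓘(ℝ, E) φ.symm y := ContinuousLinearMap.inverse_eq h2 h1
  have h4 : (mfderiv 𝓘(ℝ, E) 𝓘(ℝ, E) φ.symm y).inverse =
      mfderiv 𝓘(ℝ, E) 𝓘(ℝ, E) φ (φ.symm y) := ContinuousLinearMap.inverse_eq h1 h2
  have h5 : V (φ.symm y) = mfderiv 𝓘(ℝ, E) 𝓘(ℝ, E) φ.symm y v := by rw [← h3]; rfl
  change (mfderiv 𝓘(ℝ, E) 𝓘(ℝ, E) φ.symm y).inverse (X (φ.symm y)) = v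
  rw [h4, hy, h5]
  exact congrArg (fun L ↦ L v) h2

omit [IsManifold 𝓘(ℝ, E) ∞ M] [FiniteDimensional ℝ E] in
lemma eventually_extChartAt_symm {x : M} {p : M → Prop} (h : ∀ᶠ y in 𝓝 x, p y) :
    ∀ᶠ y in 𝓝 (extChartAt 𝓘(ℝ, E) x x), p ((extChartAt 𝓘(ℝ, E) x).symm y) := by
  refine Filter.Tendsto.eventually (p := p) (continuousAt_extChartAt_symm x) ?_
  rwa [extChartAt_to_inv]

omit [FiniteDimensional ℝ E] in
lemma contDiffAt_comp_extChartAt_symm {x : M} {f : M → ℝ}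
    (hf : ContMDiffAt 𝓘(ℝ, E) 𝓘(ℝ, ℝ) ∞ f x) :
    ContDiffAt ℝ ∞ (f ∘ (extChartAt 𝓘(ℝ, E) x).symm) (extChartAt 𝓘(ℝ, E) x x) := by
  rw [← contMDiffAt_iff_contDiffAt]
  exact ContMDiffAt.comp_of_eq hf (contMDiffAt_extChartAt_symm (mem_extChartAt_target x))
    (extChartAt_to_inv x)

omit [FiniteDimensional ℝ E] in
lemma mvfderiv_eq_fderiv_chart {x : M} {f : M → ℝ} (hf : MDifferentiableAt 𝓘(ℝ, E) 𝓘(ℝ, ℝ) f x)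
    (X : (y : M) → Tan E y) :
    mvfderiv 𝓘(ℝ, E) f x (X x) = fderiv ℝ (f ∘ (extChartAt 𝓘(ℝ, E) x).symm)
      (extChartAt 𝓘(ℝ, E) x x) (chartField x X (extChartAt 𝓘(ℝ, E) x x)) := by
  rw [fderiv_comp_extChartAt_symm (mem_extChartAt_target x) (by rwa [extChartAt_to_inv])]
  have h2 : ∀ z, z = x → mvfderiv 𝓘(ℝ, E) f x (X x) = mvfderiv 𝓘(ℝ, E) f z (X z) := by
    rintro z rfl; rfl
  exact h2 _ (extChartAt_to_inv x)

omit [FiniteDimensional ℝ E] in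
/-- Derivatives of smooth functions along smooth fields, in a chart. -/
lemma eventually_fderiv_comp_extChartAt_symm {x : M} {f : M → ℝ}
    (hf : ContMDiffAt 𝓘(ℝ, E) 𝓘(ℝ, ℝ) ∞ f x) (X : (y : M) → Tan E y) :
    ∀ᶠ y in 𝓝 (extChartAt 𝓘(ℝ, E) x x),
      mvfderiv 𝓘(ℝ, E) f ((extChartAt 𝓘(ℝ, E) x).symm y)
          (X ((extChartAt 𝓘(ℝ, E) x).symm y)) =
        fderiv ℝ (f ∘ (extChartAt 𝓘(ℝ, E) x).symm) y (chartField x X y) := by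
  have h1 : ∀ᶠ y in 𝓝 x, MDifferentiableAt 𝓘(ℝ, E) 𝓘(ℝ, ℝ) f y := by
    have h2 : ContMDiffAt 𝓘(ℝ, E) 𝓘(ℝ, ℝ) 1 f x := hf.of_le (by simp)
    filter_upwards [(contMDiffAt_iff_contMDiffAt_nhds (by simp)).1 h2] with y hy
    exact hy.mdifferentiableAt one_ne_zero
  filter_upwards [eventually_extChartAt_symm h1, (isOpen_extChartAt_target x).mem_nhds
    (mem_extChartAt_target x)] with y hy hyt
  rw [fderiv_comp_extChartAt_symm hyt hy]

lemma contMDiffAt_mvfderiv {x : M} {f : M → ℝ} (hf : ContMDiffAt 𝓘(ℝ, E) 𝓘(ℝ, ℝ) ∞ f x)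
    {X : (y : M) → Tan E y} (hX : SmoothField X) :
    ContMDiffAt 𝓘(ℝ, E) 𝓘(ℝ, ℝ) ∞ (fun y ↦ mvfderiv 𝓘(ℝ, E) f y (X y)) x := by
  have h1 : ContDiffAt ℝ ∞ (fun y ↦ fderiv ℝ (f ∘ (extChartAt 𝓘(ℝ, E) x).symm) y
      (chartField x X y)) (extChartAt 𝓘(ℝ, E) x x) :=
    ((contDiffAt_comp_extChartAt_symm hf).fderiv_right (m := ∞) le_rfl).clm_apply
      (contDiffAt_chartField (hX x))
  have h2 := (h1.congr_of_eventuallyEq (eventually_fderiv_comp_extChartAt_symm hf X)).contMDiffAt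
  have h3 := h2.comp x (contMDiffAt_extChartAt (n := ∞))
  refine h3.congr_of_eventuallyEq ?_
  filter_upwards [extChartAt_source_mem_nhds (I := 𝓘(ℝ, E)) x] with y hy
  have h4 : ∀ z, z = y → mvfderiv 𝓘(ℝ, E) f y (X y) = mvfderiv 𝓘(ℝ, E) f z (X z) := by
    rintro z rfl; rfl
  exact h4 _ ((extChartAt 𝓘(ℝ, E) x).left_inv hy)

/-- The Lie bracket of vector fields as a commutator of derivations. -/
lemma mvfderiv_bracket {x : M} {f : M → ℝ} (hf : ContMDiffAt 𝓘(ℝ, E) 𝓘(ℝ, ℝ) ∞ f x)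
    {X Y : (y : M) → Tan E y} (hX : SmoothField X) (hY : SmoothField Y) :
    mvfderiv 𝓘(ℝ, E) f x (bracket X Y x) =
      mvfderiv 𝓘(ℝ, E) (fun y ↦ mvfderiv 𝓘(ℝ, E) f y (Y y)) x (X x) -
        mvfderiv 𝓘(ℝ, E) (fun y ↦ mvfderiv 𝓘(ℝ, E) f y (X y)) x (Y x) := by
  have hf' := contDiffAt_comp_extChartAt_symm hf
  have hd : DifferentiableAt ℝ (fderiv ℝ (f ∘ (extChartAt 𝓘(ℝ, E) x).symm))
      (extChartAt 𝓘(ℝ, E) x x) :=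
    (hf'.fderiv_right (m := ∞) le_rfl).differentiableAt (by simp)
  -- In the chart, `X (Y f) = D²f(X, Y) + Df(DY · X)`. The symmetric Hessian drops out of the
  -- commutator, leaving `Df` on the bracket.
  have key : ∀ {X Y : (y : M) → Tan E y}, SmoothField X → SmoothField Y →
      mvfderiv 𝓘(ℝ, E) (fun y ↦ mvfderiv 𝓘(ℝ, E) f y (Y y)) x (X x) =
      fderiv ℝ (fderiv ℝ (f ∘ (extChartAt 𝓘(ℝ, E) x).symm)) (extChartAt 𝓘(ℝ, E) x x)
        (chartField x X (extChartAt 𝓘(ℝ, E) x x)) (chartField x Y (extChartAt 𝓘(ℝ, E) x x)) +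
      fderiv ℝ (f ∘ (extChartAt 𝓘(ℝ, E) x).symm) (extChartAt 𝓘(ℝ, E) x x)
        (fderiv ℝ (chartField x Y) (extChartAt 𝓘(ℝ, E) x x)
          (chartField x X (extChartAt 𝓘(ℝ, E) x x))) := by
    intro X Y hX hY
    have he : (fun y ↦ mvfderiv 𝓘(ℝ, E) f y (Y y)) ∘ (extChartAt 𝓘(ℝ, E) x).symm
        =ᶠ[𝓝 (extChartAt 𝓘(ℝ, E) x x)]
          fun y ↦ fderiv ℝ (f ∘ (extChartAt 𝓘(ℝ, E) x).symm) y (chartField x Y y) :=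
      eventually_fderiv_comp_extChartAt_symm hf Y
    rw [mvfderiv_eq_fderiv_chart ((contMDiffAt_mvfderiv hf hY).mdifferentiableAt (by simp)),
      he.fderiv_eq,
      fderiv_clm_apply hd ((contDiffAt_chartField (hY x)).differentiableAt (by simp))]
    simp [add_comm]
  rw [key hX hY, key hY hX, mvfderiv_eq_fderiv_chart (hf.mdifferentiableAt (by simp)),
    chartField_extChartAt_self, bracket_eq_lieBracket, lieBracket_eq]
  have hs : IsSymmSndFDerivAt ℝ (f ∘ (extChartAt 𝓘(ℝ, E) x).symm) (extChartAt 𝓘(ℝ, E) x x) :=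
    hf'.isSymmSndFDerivAt (by
      rw [minSmoothness_of_isRCLikeNormedField]; exact ENat.LEInfty.out)
  rw [hs.eq]
  simp

end Calculus

/-! ### Smooth forms and the invariant formula for the exterior derivative. -/

section Forms

open VectorField

variable {E : Type*} [NormedAddCommGroup E] [NormedSpace ℝ E]
  {M : Type*} [TopologicalSpace M] [ChartedSpace E M] [IsManifold 𝓘(ℝ, E) ∞ M]

/-- A differential form is smooth at `x` if its values on smooth vector fields are. -/
def SmoothFormAt {k : ℕ} (η : Form E M k) (x : M) : Prop :=
  ∀ X : Fin k → (y : M) → Tan E y, (∀ i, SmoothField (X i)) →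
    ContMDiffAt 𝓘(ℝ, E) 𝓘(ℝ, ℝ) ∞ (fun y ↦ η y (fun i ↦ X i y)) x

lemma chartForm_extChartAt_self {k : ℕ} (x : M) (η : Form E M k) (v : Fin k → Tan E x) :
    chartForm x η (extChartAt 𝓘(ℝ, E) x x) v = η x v := by
  have h2 : ∀ z, z = x → ∀ w : Fin k → E, η z w = η x w := by rintro z rfl w; rfl
  have h1 := mfderivWithin_range_extChartAt_symm (I := 𝓘(ℝ, E)) (x := x)
  simp only [modelWithCornersSelf_coe, Set.range_id, mfderivWithin_univ] at h1
  refine Eq.trans ?_ (h2 _ (extChartAt_to_inv (I := 𝓘(ℝ, E)) x) v)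
  refine congrArg (η ((extChartAt 𝓘(ℝ, E) x).symm (extChartAt 𝓘(ℝ, E) x x))) (funext fun i ↦ ?_)
  exact congrArg (fun L : E →L[ℝ] E ↦ L (v i)) h1

variable [FiniteDimensional ℝ E]

/-- A map into the alternating forms is smooth if its values on constant vectors are. -/
lemma contDiffAt_of_forall_apply {k : ℕ} {F : E → E [⋀^Fin k]→L[ℝ] ℝ} {y : E} {m : ℕ∞ω}
    (h : ∀ v : Fin k → E, ContDiffAt ℝ m (fun z ↦ F z v) y) : ContDiffAt ℝ m F y := by
  let e := Module.finBasis ℝ E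
  -- Evaluation on tuples of basis vectors is injective; a linear left inverse on this
  -- finite-dimensional target is continuous and recovers `F` smoothly from its coefficients.
  let L : (E [⋀^Fin k]→L[ℝ] ℝ) →ₗ[ℝ] ((Fin k → Fin (Module.finrank ℝ E)) → ℝ) :=
    { toFun := fun φ σ ↦ φ (fun i ↦ e (σ i))
      map_add' := fun φ ψ ↦ rfl
      map_smul' := fun c φ ↦ rfl }
  have hL : LinearMap.ker L = ⊥ := by
    refine LinearMap.ker_eq_bot.2 fun φ ψ hφψ ↦ ?_
    have : φ.toAlternatingMap = ψ.toAlternatingMap :=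
      Module.Basis.ext_alternating e fun σ _ ↦ congrFun hφψ σ
    exact ContinuousAlternatingMap.toAlternatingMap_injective this
  obtain ⟨R, hR⟩ := LinearMap.exists_leftInverse_of_injective L hL
  have h1 : F = fun z ↦ R.toContinuousLinearMap (L (F z)) := by
    funext z
    exact (congrArg (fun T ↦ T (F z)) hR).symm
  rw [h1]
  exact R.toContinuousLinearMap.contDiff.contDiffAt.comp y
    (contDiffAt_pi.2 fun σ ↦ h fun i ↦ e (σ i))

/-- Chart coefficients are values of `η` on global fields that are constant in the chart near `x`.
The chart may be centred at another point `x₀`, as the Poincaré lemma requires. -/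
lemma SmoothFormAt.contDiffAt_chartForm [T2Space M] {k : ℕ} {η : Form E M k} {x x₀ : M}
    (hη : SmoothFormAt η x) (hx : x ∈ (extChartAt 𝓘(ℝ, E) x₀).source) :
    ContDiffAt ℝ ∞ (chartForm x₀ η) (extChartAt 𝓘(ℝ, E) x₀ x) := by
  refine contDiffAt_of_forall_apply fun v ↦ ?_
  choose X hX hXv using fun i ↦ SmoothField.exists_chartField_eq hx (v i)
  have ht := (extChartAt 𝓘(ℝ, E) x₀).map_source hx
  have h1 : ContMDiffAt 𝓘(ℝ, E) 𝓘(ℝ, ℝ) ∞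
      ((fun y ↦ η y (fun i ↦ X i y)) ∘ (extChartAt 𝓘(ℝ, E) x₀).symm)
      (extChartAt 𝓘(ℝ, E) x₀ x) :=
    ContMDiffAt.comp_of_eq (hη X hX) (contMDiffAt_extChartAt_symm ht)
      ((extChartAt 𝓘(ℝ, E) x₀).left_inv hx)
  refine h1.contDiffAt.congr_of_eventuallyEq ?_
  filter_upwards [Filter.eventually_all.2 hXv, (isOpen_extChartAt_target x₀).mem_nhds ht]
    with y hy hyt
  rw [Function.comp_apply, ← chartForm_chartField hyt]
  simp only [hy]

/-- The invariant formula for the exterior derivative. -/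
lemma extD_apply_fields [T2Space M] {k : ℕ} {η : Form E M (k + 1)} {x : M}
    (hη : SmoothFormAt η x) (X : Fin (k + 2) → (y : M) → Tan E y) (hX : ∀ i, SmoothField (X i)) :
    extD η x (fun i ↦ X i x) =
      (∑ i, (-1) ^ i.val • mvfderiv 𝓘(ℝ, E) (fun y ↦ η y (i.removeNth (fun j ↦ X j y))) x (X i x)) -
        ∑ i : Fin (k + 1), ∑ j ≥ i, (-1) ^ (i + j : ℕ) •
          η x (Matrix.vecCons (bracket (X i.castSucc) (X j.succ) x)
            (j.removeNth <| i.castSucc.removeNth (fun j ↦ X j x))) := by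
  have hself : (fun i ↦ X i x) = fun i ↦ chartField x (X i) (extChartAt 𝓘(ℝ, E) x x) :=
    funext fun i ↦ (chartField_extChartAt_self x (X i)).symm
  have ht := mem_extChartAt_target (I := 𝓘(ℝ, E)) x
  rw [extD_eq_extDeriv, hself, extDeriv_apply_vectorField (V := fun i ↦ chartField x (X i))
    ((hη.contDiffAt_chartForm (mem_extChartAt_source x)).differentiableAt (by simp))
    (fun i ↦ (contDiffAt_chartField (hX i x)).differentiableAt (by simp))]
  congr 1
  · refine Finset.sum_congr rfl fun i _ ↦ ?_
    congr 1
    have hs : ContMDiffAt 𝓘(ℝ, E) 𝓘(ℝ, ℝ) ∞ (fun y ↦ η y (i.removeNth (fun j ↦ X j y))) x :=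
      hη (fun j ↦ X (i.succAbove j)) (fun j ↦ hX _)
    rw [mvfderiv_eq_fderiv_chart (hs.mdifferentiableAt (by simp))]
    congr 1
    refine Filter.EventuallyEq.fderiv_eq ?_
    filter_upwards [(isOpen_extChartAt_target x).mem_nhds ht] with y hy
    exact chartForm_chartField hy η (fun j ↦ X (i.succAbove j))
  · refine Finset.sum_congr rfl fun i _ ↦ Finset.sum_congr rfl fun j _ ↦ ?_
    congr 1
    rw [bracket_eq_lieBracket, ← hself, ← chartForm_extChartAt_self]
    rfl

lemma extD_apply_one [T2Space M] {η : Form E M 1} {x : M} (hη : SmoothFormAt η x)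
    {X Y : (y : M) → Tan E y} (hX : SmoothField X) (hY : SmoothField Y) :
    extD η x ![X x, Y x] =
      mvfderiv 𝓘(ℝ, E) (fun y ↦ η y ![Y y]) x (X x) -
        mvfderiv 𝓘(ℝ, E) (fun y ↦ η y ![X y]) x (Y x) - η x ![bracket X Y x] := by
  have e0 : ![X x, Y x] = fun i ↦ (![X, Y] : Fin 2 → (y : M) → Tan E y) i x := by
    ext i; fin_cases i <;> rfl
  have e1 : (fun y ↦ η y (Fin.removeNth 0 fun j ↦ (![X, Y] : Fin 2 → (y : M) → Tan E y) j y)) =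
      fun y ↦ η y ![Y y] :=
    funext fun y ↦ congrArg (η y) (by ext i; fin_cases i; rfl)
  have e2 : (fun y ↦ η y (Fin.removeNth 1 fun j ↦ (![X, Y] : Fin 2 → (y : M) → Tan E y) j y)) =
      fun y ↦ η y ![X y] :=
    funext fun y ↦ congrArg (η y) (by ext i; fin_cases i; rfl)
  rw [e0, extD_apply_fields hη ![X, Y] (by intro i; fin_cases i <;> assumption),
    Fin.sum_univ_two, e1, e2]
  have s1 : ∀ F : Fin 1 → Fin 1 → ℝ, ∑ i, ∑ j ≥ i, F i j = F 0 0 := by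
    intro F
    rw [Fin.sum_univ_one, show Finset.Ici (0 : Fin 1) = {0} by decide, Finset.sum_singleton]
  rw [s1]
  have e3 : ∀ u : Tan E x, ∀ v : Fin 0 → Tan E x, Matrix.vecCons u v = ![u] := by
    intro u v; ext i; fin_cases i; rfl
  rw [e3]
  change (-1 : ℤ) ^ 0 • mvfderiv 𝓘(ℝ, E) (fun y ↦ η y ![Y y]) x (X x) +
    (-1 : ℤ) ^ 1 • mvfderiv 𝓘(ℝ, E) (fun y ↦ η y ![X y]) x (Y x) -
    (-1 : ℤ) ^ 0 • η x ![bracket X Y x] = _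
  simp only [pow_zero, one_smul, pow_one, neg_smul, sub_eq_add_neg]

lemma extD_apply_two [T2Space M] {η : Form E M 2} {x : M} (hη : SmoothFormAt η x)
    {X Y Z : (y : M) → Tan E y} (hX : SmoothField X) (hY : SmoothField Y) (hZ : SmoothField Z) :
    extD η x ![X x, Y x, Z x] =
      mvfderiv 𝓘(ℝ, E) (fun y ↦ η y ![Y y, Z y]) x (X x) -
        mvfderiv 𝓘(ℝ, E) (fun y ↦ η y ![X y, Z y]) x (Y x) +
        mvfderiv 𝓘(ℝ, E) (fun y ↦ η y ![X y, Y y]) x (Z x) -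
        η x ![bracket X Y x, Z x] + η x ![bracket X Z x, Y x] - η x ![bracket Y Z x, X x] := by
  have e0 : ![X x, Y x, Z x] = fun i ↦ (![X, Y, Z] : Fin 3 → (y : M) → Tan E y) i x := by
    ext i; fin_cases i <;> rfl
  have e1 : (fun y ↦ η y (Fin.removeNth 0 fun j ↦ (![X, Y, Z] : Fin 3 → (y : M) → Tan E y) j y)) =
      fun y ↦ η y ![Y y, Z y] :=
    funext fun y ↦ congrArg (η y) (by ext i; fin_cases i <;> rfl)
  have e2 : (fun y ↦ η y (Fin.removeNth 1 fun j ↦ (![X, Y, Z] : Fin 3 → (y : M) → Tan E y) j y)) =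
      fun y ↦ η y ![X y, Z y] :=
    funext fun y ↦ congrArg (η y) (by ext i; fin_cases i <;> rfl)
  have e3 : (fun y ↦ η y (Fin.removeNth 2 fun j ↦ (![X, Y, Z] : Fin 3 → (y : M) → Tan E y) j y)) =
      fun y ↦ η y ![X y, Y y] :=
    funext fun y ↦ congrArg (η y) (by ext i; fin_cases i <;> rfl)
  rw [e0, extD_apply_fields hη ![X, Y, Z] (by intro i; fin_cases i <;> assumption),
    Fin.sum_univ_three, e1, e2, e3]
  have s1 : ∀ F : Fin 2 → Fin 2 → ℝ, ∑ i, ∑ j ≥ i, F i j = F 0 0 + F 0 1 + F 1 1 := by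
    intro F
    rw [Fin.sum_univ_two, show Finset.Ici (0 : Fin 2) = {0, 1} by decide,
      show Finset.Ici (1 : Fin 2) = {1} by decide, Finset.sum_singleton,
      Finset.sum_pair (by decide)]
  rw [s1]
  have e4 : ∀ u : Tan E x, Matrix.vecCons u (Fin.removeNth 0 (Fin.removeNth (Fin.castSucc 0)
      fun j ↦ (![X, Y, Z] : Fin 3 → (y : M) → Tan E y) j x)) = ![u, Z x] := by
    intro u; ext i; fin_cases i <;> rfl
  have e5 : ∀ u : Tan E x, Matrix.vecCons u (Fin.removeNth 1 (Fin.removeNth (Fin.castSucc 0)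
      fun j ↦ (![X, Y, Z] : Fin 3 → (y : M) → Tan E y) j x)) = ![u, Y x] := by
    intro u; ext i; fin_cases i <;> rfl
  have e6 : ∀ u : Tan E x, Matrix.vecCons u (Fin.removeNth 1 (Fin.removeNth (Fin.castSucc 1)
      fun j ↦ (![X, Y, Z] : Fin 3 → (y : M) → Tan E y) j x)) = ![u, X x] := by
    intro u; ext i; fin_cases i <;> rfl
  rw [e4, e5, e6]
  change (-1 : ℤ) ^ 0 • mvfderiv 𝓘(ℝ, E) (fun y ↦ η y ![Y y, Z y]) x (X x) +
    (-1 : ℤ) ^ 1 • mvfderiv 𝓘(ℝ, E) (fun y ↦ η y ![X y, Z y]) x (Y x) +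
    (-1 : ℤ) ^ 2 • mvfderiv 𝓘(ℝ, E) (fun y ↦ η y ![X y, Y y]) x (Z x) -
    ((-1 : ℤ) ^ 0 • η x ![bracket X Y x, Z x] + (-1 : ℤ) ^ 1 • η x ![bracket X Z x, Y x] +
      (-1 : ℤ) ^ 2 • η x ![bracket Y Z x, X x]) = _
  simp only [pow_zero, one_smul, pow_one, neg_smul, sub_eq_add_neg, even_two, Even.neg_pow,
    one_pow]
  ring

end Forms

/-! ### Derivation rules and smoothness of the tensors involved. -/

section Smoothness

open VectorField

variable {E : Type*} [NormedAddCommGroup E] [NormedSpace ℝ E]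
  {M : Type*} [TopologicalSpace M] [ChartedSpace E M]

lemma mvfderiv_congr {f g : M → ℝ} {x : M} (h : f =ᶠ[𝓝 x] g) :
    mvfderiv 𝓘(ℝ, E) f x = mvfderiv 𝓘(ℝ, E) g x := by
  have h1 : mfderiv 𝓘(ℝ, E) 𝓘(ℝ, ℝ) f x = mfderiv 𝓘(ℝ, E) 𝓘(ℝ, ℝ) g x := h.mfderiv_eq
  exact h1

lemma mvfderiv_mul_apply {f g : M → ℝ} {x : M} (hf : ContMDiffAt 𝓘(ℝ, E) 𝓘(ℝ, ℝ) ∞ f x)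
    (hg : ContMDiffAt 𝓘(ℝ, E) 𝓘(ℝ, ℝ) ∞ g x) (v : Tan E x) :
    mvfderiv 𝓘(ℝ, E) (fun y ↦ f y * g y) x v =
      f x * mvfderiv 𝓘(ℝ, E) g x v + g x * mvfderiv 𝓘(ℝ, E) f x v := by
  rw [mvfderiv_fun_mul (hf.mdifferentiableAt (by simp)) (hg.mdifferentiableAt (by simp))]
  rfl

lemma mvfderiv_sub_apply {f g : M → ℝ} {x : M} (hf : ContMDiffAt 𝓘(ℝ, E) 𝓘(ℝ, ℝ) ∞ f x)
    (hg : ContMDiffAt 𝓘(ℝ, E) 𝓘(ℝ, ℝ) ∞ g x) (v : Tan E x) :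
    mvfderiv 𝓘(ℝ, E) (fun y ↦ f y - g y) x v =
      mvfderiv 𝓘(ℝ, E) f x v - mvfderiv 𝓘(ℝ, E) g x v := by
  rw [mvfderiv_fun_sub (hf.mdifferentiableAt (by simp)) (hg.mdifferentiableAt (by simp))]
  rfl

lemma mvfderiv_add_apply {f g : M → ℝ} {x : M} (hf : ContMDiffAt 𝓘(ℝ, E) 𝓘(ℝ, ℝ) ∞ f x)
    (hg : ContMDiffAt 𝓘(ℝ, E) 𝓘(ℝ, ℝ) ∞ g x) (v : Tan E x) :
    mvfderiv 𝓘(ℝ, E) (fun y ↦ f y + g y) x v =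
      mvfderiv 𝓘(ℝ, E) f x v + mvfderiv 𝓘(ℝ, E) g x v := by
  rw [mvfderiv_fun_add (hf.mdifferentiableAt (by simp)) (hg.mdifferentiableAt (by simp))]
  rfl

lemma mvfderiv_neg_apply {f : M → ℝ} {x : M} (v : Tan E x) :
    mvfderiv 𝓘(ℝ, E) (fun y ↦ -f y) x v = -mvfderiv 𝓘(ℝ, E) f x v := by
  rw [mvfderiv_fun_neg]
  rfl

lemma contMDiffAt_det {ι : Type*} [Fintype ι] [DecidableEq ι] {A : M → Matrix ι ι ℝ} {x : M}
    (h : ∀ i j, ContMDiffAt 𝓘(ℝ, E) 𝓘(ℝ, ℝ) ∞ (fun y ↦ A y i j) x) :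
    ContMDiffAt 𝓘(ℝ, E) 𝓘(ℝ, ℝ) ∞ (fun y ↦ (A y).det) x := by
  simp only [Matrix.det_apply']
  refine contMDiffAt_finsetSum fun σ _ ↦ ?_
  exact contMDiffAt_const.mul (contMDiffAt_finsetProd fun i _ ↦ h _ _)

/-- By Cramer's rule the entries of the inverse are quotients of determinants in smooth entries. -/
lemma contMDiffAt_matrix_inv {ι : Type*} [Fintype ι] [DecidableEq ι] {A : M → Matrix ι ι ℝ} {x : M}
    (h : ∀ i j, ContMDiffAt 𝓘(ℝ, E) 𝓘(ℝ, ℝ) ∞ (fun y ↦ A y i j) x) (h0 : (A x).det ≠ 0) (i j : ι) :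
    ContMDiffAt 𝓘(ℝ, E) 𝓘(ℝ, ℝ) ∞ (fun y ↦ (A y)⁻¹ i j) x := by
  simp only [Matrix.inv_def, Ring.inverse_eq_inv', Matrix.smul_apply, smul_eq_mul,
    Matrix.adjugate_apply]
  refine ContMDiffAt.mul ?_ (contMDiffAt_det fun k l ↦ ?_)
  · exact (contDiffAt_inv ℝ h0).contMDiffAt.comp x (contMDiffAt_det h)
  · rcases eq_or_ne k j with rfl | hk
    · simp only [Matrix.updateRow_self]
      exact contMDiffAt_const
    · simp only [Matrix.updateRow_ne hk]
      exact h k l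

variable [IsManifold 𝓘(ℝ, E) ∞ M]

lemma Metric.contMDiff_inner (g : Metric E M) {X Y : (y : M) → Tan E y} (hX : SmoothField X)
    (hY : SmoothField Y) :
    ContMDiff 𝓘(ℝ, E) 𝓘(ℝ, ℝ) ∞ (fun y ↦ g.inner y (X y) (Y y)) := by
  intro x
  have h := ContMDiffAt.clm_bundle_apply₂ (F₁ := E) (F₂ := E) (F₃ := ℝ) (b := fun y : M ↦ y)
    (E₁ := fun y : M ↦ TangentSpace 𝓘(ℝ, E) y) (E₂ := fun y : M ↦ TangentSpace 𝓘(ℝ, E) y)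
    (E₃ := Bundle.Trivial M ℝ) (g.contMDiff x) (hX x) (hY x)
  simpa [Bundle.contMDiffAt_section] using h

lemma AlmostComplex.smoothField_app (J : AlmostComplex E M) {X : (y : M) → Tan E y}
    (hX : SmoothField X) : SmoothField (J.app X) := fun x ↦
  ContMDiffAt.clm_bundle_apply (F₁ := E) (F₂ := E) (b := fun y : M ↦ y)
    (E₁ := fun y : M ↦ TangentSpace 𝓘(ℝ, E) y) (E₂ := fun y : M ↦ TangentSpace 𝓘(ℝ, E) y)
    (J.contMDiff x) (hX x)

lemma SmoothFormAt.congr {k : ℕ} {Ω Ω' : Form E M k} {x : M} (h : SmoothFormAt Ω x)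
    (h' : ∀ᶠ y in 𝓝 x, Ω' y = Ω y) : SmoothFormAt Ω' x := fun X hX ↦
  (h X hX).congr_of_eventuallyEq (by filter_upwards [h'] with y hy; rw [hy])

lemma SmoothFormAt.smul {k : ℕ} {Ω : Form E M k} {f : M → ℝ} {x : M} (h : SmoothFormAt Ω x)
    (hf : ContMDiffAt 𝓘(ℝ, E) 𝓘(ℝ, ℝ) ∞ f x) : SmoothFormAt (fun y ↦ f y • Ω y) x := fun X hX ↦
  hf.mul (h X hX)

lemma SmoothFormAt.contMDiffAt_apply_two {Ω : Form E M 2} {x : M} (h : SmoothFormAt Ω x)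
    {X Y : (y : M) → Tan E y} (hX : SmoothField X) (hY : SmoothField Y) :
    ContMDiffAt 𝓘(ℝ, E) 𝓘(ℝ, ℝ) ∞ (fun y ↦ Ω y ![X y, Y y]) x := by
  have := h ![X, Y] (by intro i; fin_cases i <;> assumption)
  convert this using 3 with y
  ext i; fin_cases i <;> rfl

variable [FiniteDimensional ℝ E]

lemma SmoothField.bracket {X Y : (y : M) → Tan E y} (hX : SmoothField X) (hY : SmoothField Y) :
    SmoothField (bracket X Y) := by
  have : IsManifold 𝓘(ℝ, E) (minSmoothness ℝ 2) M := by
    rw [minSmoothness_of_isRCLikeNormedField]; infer_instance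
  have : IsManifold 𝓘(ℝ, E) (((⊤ : ℕ∞) : ℕ∞ω) + 1) M := inferInstanceAs (IsManifold 𝓘(ℝ, E) ∞ M)
  exact ContDiff.mlieBracket_vectorField (m := ⊤) (n := ⊤) hX hY
    (by rw [minSmoothness_of_isRCLikeNormedField]; exact le_rfl)

lemma SmoothFormAt.extD_two [T2Space M] {Ω : Form E M 2} (hΩ : ∀ x, SmoothFormAt Ω x) (x : M) :
    SmoothFormAt (extD Ω) x := by
  intro X hX
  have h : (fun y ↦ extD Ω y (fun i ↦ X i y)) = fun y ↦
      mvfderiv 𝓘(ℝ, E) (fun y ↦ Ω y ![X 1 y, X 2 y]) y (X 0 y) -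
        mvfderiv 𝓘(ℝ, E) (fun y ↦ Ω y ![X 0 y, X 2 y]) y (X 1 y) +
        mvfderiv 𝓘(ℝ, E) (fun y ↦ Ω y ![X 0 y, X 1 y]) y (X 2 y) -
        Ω y ![LCK.bracket (X 0) (X 1) y, X 2 y] + Ω y ![LCK.bracket (X 0) (X 2) y, X 1 y] -
          Ω y ![LCK.bracket (X 1) (X 2) y, X 0 y] := by
    funext y
    rw [← extD_apply_two (hΩ y) (hX 0) (hX 1) (hX 2)]
    congr 1
    ext i; fin_cases i <;> rfl
  have hs : ∀ {X Y : (y : M) → Tan E y}, SmoothField X → SmoothField Y →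
      ContMDiffAt 𝓘(ℝ, E) 𝓘(ℝ, ℝ) ∞ (fun y ↦ Ω y ![X y, Y y]) x := (hΩ x).contMDiffAt_apply_two
  rw [h]
  exact (((((contMDiffAt_mvfderiv (hs (hX 1) (hX 2)) (hX 0)).sub
    (contMDiffAt_mvfderiv (hs (hX 0) (hX 2)) (hX 1))).add
    (contMDiffAt_mvfderiv (hs (hX 0) (hX 1)) (hX 2))).sub
    (hs ((hX 0).bracket (hX 1)) (hX 2))).add (hs ((hX 0).bracket (hX 2)) (hX 1))).sub
    (hs ((hX 1).bracket (hX 2)) (hX 0))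

/-- The exterior derivative of the product of a function and a `2`-form. -/
lemma extD_smul_two [T2Space M] {Ω Ω' : Form E M 2} {f : M → ℝ} {x : M} (h : SmoothFormAt Ω x)
    (hf : ContMDiffAt 𝓘(ℝ, E) 𝓘(ℝ, ℝ) ∞ f x) (h' : ∀ᶠ y in 𝓝 x, Ω' y = f y • Ω y) :
    (extD Ω' x).toAlternatingMap =
      wedge (mvfderiv 𝓘(ℝ, E) f x).toLinearMap (Ω x).toAlternatingMap +
        f x • (extD Ω x).toAlternatingMap := by
  refine alternating_three_ext fun u v w ↦ ?_
  obtain ⟨X, hX, rfl⟩ := SmoothField.exists_eq u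
  obtain ⟨Y, hY, rfl⟩ := SmoothField.exists_eq v
  obtain ⟨Z, hZ, rfl⟩ := SmoothField.exists_eq w
  have hΩ' : SmoothFormAt Ω' x := (h.smul hf).congr h'
  have key : ∀ {X Y : (y : M) → Tan E y}, SmoothField X → SmoothField Y → ∀ v : Tan E x,
      mvfderiv 𝓘(ℝ, E) (fun y ↦ Ω' y ![X y, Y y]) x v =
        f x * mvfderiv 𝓘(ℝ, E) (fun y ↦ Ω y ![X y, Y y]) x v +
          Ω x ![X x, Y x] * mvfderiv 𝓘(ℝ, E) f x v := by
    intro X Y hX hY v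
    rw [← mvfderiv_mul_apply hf (h.contMDiffAt_apply_two hX hY)]
    refine congrArg (fun L : E →L[ℝ] ℝ ↦ L v) (mvfderiv_congr ?_)
    filter_upwards [h'] with y hy
    rw [hy]; rfl
  have hx : ∀ v, Ω' x v = f x * Ω x v := fun v ↦ by rw [h'.self_of_nhds]; rfl
  rw [AlternatingMap.add_apply, AlternatingMap.smul_apply, wedge_apply]
  change extD Ω' x ![X x, Y x, Z x] = mvfderiv 𝓘(ℝ, E) f x (X x) * Ω x ![Y x, Z x] -
    mvfderiv 𝓘(ℝ, E) f x (Y x) * Ω x ![X x, Z x] + mvfderiv 𝓘(ℝ, E) f x (Z x) * Ω x ![X x, Y x] +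
    f x * extD Ω x ![X x, Y x, Z x]
  rw [extD_apply_two hΩ' hX hY hZ, extD_apply_two h hX hY hZ, key hY hZ, key hX hZ, key hX hY,
    hx, hx, hx]
  ring

end Smoothness

/-! ### Existence, uniqueness and smoothness of the Lee form. -/

namespace ConfAlmostHermitian

open VectorField

variable {E : Type*} [NormedAddCommGroup E] [NormedSpace ℝ E]
  {M : Type*} [TopologicalSpace M] [ChartedSpace E M] [IsManifold 𝓘(ℝ, E) ∞ M]
  (S : ConfAlmostHermitian E M)

lemma inner_J_right (g : S.Gauge) (x : M) (u v : Tan E x) :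
    g.1.inner x u (S.J.toFun x v) = -g.1.inner x (S.J.toFun x u) v := by
  rw [← S.compatible g.1 g.2 x u, S.J.sq, map_neg]

lemma isHermitianTriple (g : S.Gauge) (x : M) :
    IsHermitianTriple (g.1.bilin x) (S.J.toFun x).toLinearMap
      (S.fundForm g x).toAlternatingMap where
  symm u v := g.1.symm x u v
  pos u hu := g.1.pos x u hu
  sq u := S.J.sq x u
  orth u v := S.compatible g.1 g.2 x u v
  fund _ _ := rfl

lemma smoothFormAt_fundForm (g : S.Gauge) (x : M) : SmoothFormAt (S.fundForm g) x := fun _ hX ↦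
  g.1.contMDiff_inner (S.J.smoothField_app (hX 0)) (hX 1) x

instance (x : M) : T2Space (Tan E x) := inferInstanceAs (T2Space E)

variable [FiniteDimensional ℝ E]

lemma isLee_iff (g : S.Gauge) (x : M) (η : Tan E x →L[ℝ] ℝ)
    (f : Module.Basis (Fin (Module.finrank ℝ (Tan E x))) ℝ (Tan E x)) :
    S.IsLee g x η ↔ ∀ u, contraction (g.1.bilin x) f (S.J.toFun x).toLinearMap
      (extD (S.fundForm g) x).toAlternatingMap u = ((Module.finrank ℝ E : ℝ) - 2) * η u := by
  have h := S.isHermitianTriple g x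
  obtain ⟨e, he⟩ := h.exists_ON
  have h1 : S.IsLee g x η ↔ ∀ θ : Tan E x →ₗ[ℝ] ℝ, FormOrthogonal (g.1.bilin x)
      ((extD (S.fundForm g) x).toAlternatingMap -
      wedge η.toLinearMap (S.fundForm g x).toAlternatingMap)
    (wedge θ (S.fundForm g x).toAlternatingMap) :=
    ⟨fun H θ ↦ H θ.toContinuousLinearMap, fun H θ ↦ H θ.toLinearMap⟩
  rw [h1, forall_formOrthogonal_wedge_iff h f]
  refine forall_congr' fun u ↦ ?_
  rw [contraction_sub, contraction_wedge h he, sub_eq_zero, Fintype.card_fin]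
  rfl

omit [FiniteDimensional ℝ E] in
lemma finrank_sub_two_ne_zero (hdim : 4 ≤ Module.finrank ℝ E) :
    (Module.finrank ℝ E : ℝ) - 2 ≠ 0 := by
  have : (4 : ℝ) ≤ Module.finrank ℝ E := by exact_mod_cast hdim
  linarith

variable (hdim : 4 ≤ Module.finrank ℝ E)
include hdim

lemma isLee_lee (g : S.Gauge) (x : M) : S.IsLee g x (S.lee g x) := by
  refine Classical.epsilon_spec (p := fun η ↦ S.IsLee g x η) ?_
  obtain ⟨e, he⟩ := (S.isHermitianTriple g x).exists_ON
  -- The contraction of `dΩ` divided by `n - 2`, the only candidate by `isLee_iff`.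
  let φ : Tan E x →ₗ[ℝ] ℝ := ((Module.finrank ℝ E : ℝ) - 2)⁻¹ • ∑ i,
    ((trilin (extD (S.fundForm g) x).toAlternatingMap).flip (e i)).flip (S.J.toFun x (e i))
  refine ⟨φ.toContinuousLinearMap, (S.isLee_iff g x _ e).2 fun u ↦ ?_⟩
  rw [contraction_eq he]
  simp only [φ, LinearMap.coe_toContinuousLinearMap', LinearMap.smul_apply, LinearMap.sum_apply,
    LinearMap.flip_apply, trilin_apply, smul_eq_mul]
  rw [mul_inv_cancel_left₀ (finrank_sub_two_ne_zero hdim)]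
  rfl

lemma lee_apply (g : S.Gauge) (x : M)
    (f : Module.Basis (Fin (Module.finrank ℝ (Tan E x))) ℝ (Tan E x)) (u : Tan E x) :
    S.lee g x u = ((Module.finrank ℝ E : ℝ) - 2)⁻¹ * contraction (g.1.bilin x) f
      (S.J.toFun x).toLinearMap (extD (S.fundForm g) x).toAlternatingMap u := by
  rw [(S.isLee_iff g x _ f).1 (S.isLee_lee hdim g x),
    inv_mul_cancel_left₀ (finrank_sub_two_ne_zero hdim)]

lemma eq_lee_of_isLee {g : S.Gauge} {x : M} {η : Tan E x →L[ℝ] ℝ} (h : S.IsLee g x η) :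
    η = S.lee g x := by
  obtain ⟨e, -⟩ := (S.isHermitianTriple g x).exists_ON
  ext u
  rw [S.lee_apply hdim g x e, (S.isLee_iff g x η e).1 h,
    inv_mul_cancel_left₀ (finrank_sub_two_ne_zero hdim)]

/-- If `dΩ_g = η ∧ Ω_g`, then `η` is the Lee form. -/
lemma eq_lee_of_extD_eq {g : S.Gauge} {x : M} {η : Tan E x →L[ℝ] ℝ}
    (h : (extD (S.fundForm g) x).toAlternatingMap =
      wedge η.toLinearMap (S.fundForm g x).toAlternatingMap) :
    η = S.lee g x ∧ S.dFundForm₀ g x = 0 := by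
  have h1 : S.IsLee g x η := by
    intro θ e he
    simp [h]
  have h2 := S.eq_lee_of_isLee hdim h1
  refine ⟨h2, ?_⟩
  rw [dFundForm₀, ← h2, h, sub_self]

variable [T2Space M]

/-- Smooth fields extending a basis at `x` form a frame wherever their Gram determinant is nonzero.
There the contraction formula expresses the Lee form through smooth functions, without
orthonormalizing the frame. -/
lemma contMDiffAt_lee (g : S.Gauge) {X : (y : M) → Tan E y} (hX : SmoothField X) (x : M) :
    ContMDiffAt 𝓘(ℝ, E) 𝓘(ℝ, ℝ) ∞ (fun y ↦ S.lee g y (X y)) x := by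
  obtain ⟨e, he⟩ := (S.isHermitianTriple g x).exists_ON
  choose F hF hFe using fun i ↦ SmoothField.exists_eq (e i)
  have hG : ∀ i j, ContMDiffAt 𝓘(ℝ, E) 𝓘(ℝ, ℝ) ∞
      (fun y ↦ gram (g.1.bilin y) (fun k ↦ F k y) i j) x := fun i j ↦
    g.1.contMDiff_inner (hF i) (hF j) x
  have h0 : (gram (g.1.bilin x) (fun k ↦ F k x)).det ≠ 0 := by
    rw [show (fun k ↦ F k x) = e from funext hFe]
    exact (he.gram_det_pos e e.linearIndependent (by simp)).ne'
  have hev : ∀ᶠ y in 𝓝 x, (gram (g.1.bilin y) (fun k ↦ F k y)).det ≠ 0 :=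
    (contMDiffAt_det hG).continuousAt.eventually_ne h0
  have hsm : ContMDiffAt 𝓘(ℝ, E) 𝓘(ℝ, ℝ) ∞ (fun y ↦ ((Module.finrank ℝ E : ℝ) - 2)⁻¹ * ∑ i, ∑ j,
      (gram (g.1.bilin y) (fun k ↦ F k y))⁻¹ i j *
        extD (S.fundForm g) y ![X y, F i y, S.J.app (F j) y]) x := by
    refine contMDiffAt_const.mul (contMDiffAt_finsetSum fun i _ ↦ contMDiffAt_finsetSum fun j _ ↦
      (contMDiffAt_matrix_inv hG h0 i j).mul ?_)
    have := SmoothFormAt.extD_two (S.smoothFormAt_fundForm g) x ![X, F i, S.J.app (F j)] (by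
      intro k; fin_cases k
      exacts [hX, hF i, S.J.smoothField_app (hF j)])
    convert this using 3 with y
    ext k; fin_cases k <;> rfl
  refine hsm.congr_of_eventuallyEq ?_
  filter_upwards [hev] with y hy
  obtain ⟨e', he'⟩ := (S.isHermitianTriple g y).exists_ON
  have hli := he'.linearIndependent_of_gram_det_ne_zero _ hy
  have hne : Nonempty (Fin (Module.finrank ℝ (Tan E y))) :=
    ⟨⟨0, lt_of_lt_of_le (by norm_num) hdim⟩⟩
  obtain ⟨B, hB⟩ : ∃ B : Module.Basis (Fin (Module.finrank ℝ (Tan E y))) ℝ (Tan E y),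
      ⇑B = fun k ↦ F k y :=
    ⟨_, coe_basisOfLinearIndependentOfCardEqFinrank hli (Fintype.card_fin _)⟩
  rw [S.lee_apply hdim g y B]
  simp only [contraction, hB]
  rfl

lemma smoothFormAt_leeForm (g : S.Gauge) (x : M) : SmoothFormAt (S.leeForm g) x := fun _ hX ↦
  S.contMDiffAt_lee hdim g (hX 0) x

lemma extD_leeForm_apply (g : S.Gauge) {X Y : (y : M) → Tan E y} (hX : SmoothField X)
    (hY : SmoothField Y) (x : M) :
    extD (S.leeForm g) x ![X x, Y x] =
      mvfderiv 𝓘(ℝ, E) (fun y ↦ S.lee g y (Y y)) x (X x) -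
        mvfderiv 𝓘(ℝ, E) (fun y ↦ S.lee g y (X y)) x (Y x) - S.lee g x (bracket X Y x) :=
  extD_apply_one (S.smoothFormAt_leeForm hdim g x) hX hY

end ConfAlmostHermitian

/-! ### Change of metric within the conformal class. -/

section ConformalAlgebra

variable {V : Type*} [AddCommGroup V] [Module ℝ V] {b b' : V →ₗ[ℝ] V →ₗ[ℝ] ℝ}
  {ι : Type*} [Fintype ι] [DecidableEq ι] {e : Module.Basis ι ℝ V} {J : V →ₗ[ℝ] V}

/-- The behaviour of the contraction under a conformal change of the metric. -/
lemma contraction_of_eq_mul (he : IsON b e) {r : ℝ} (hr : r ≠ 0)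
    (h : ∀ u v, b' u v = r * b u v) (φ : V [⋀^Fin 3]→ₗ[ℝ] ℝ) (u : V) :
    contraction b' e J φ u = r⁻¹ * contraction b e J φ u := by
  have h1 : gram b e = 1 := by
    ext i j
    rw [Matrix.one_apply]
    exact he i j
  have h2 : (gram b' e)⁻¹ = r⁻¹ • (1 : Matrix ι ι ℝ) := by
    refine Matrix.inv_eq_right_inv ?_
    have : gram b' e = r • (1 : Matrix ι ι ℝ) := by
      rw [← h1]
      ext i j
      exact h _ _
    rw [this, smul_mul_smul_comm, mul_inv_cancel₀ hr, one_smul, mul_one]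
  rw [contraction, contraction, h1, h2, inv_one, Finset.mul_sum]
  refine Finset.sum_congr rfl fun i _ ↦ ?_
  rw [Finset.mul_sum]
  refine Finset.sum_congr rfl fun j _ ↦ ?_
  rw [Matrix.smul_apply, smul_eq_mul, mul_assoc]

lemma contraction_add_smul (φ ψ : V [⋀^Fin 3]→ₗ[ℝ] ℝ) (r : ℝ) (u : V) :
    contraction b e J (φ + r • ψ) u = contraction b e J φ u + r * contraction b e J ψ u := by
  simp [contraction, mul_add, Finset.sum_add_distrib, Finset.mul_sum, mul_left_comm]

end ConformalAlgebra

section Chain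

variable {E : Type*} [NormedAddCommGroup E] [NormedSpace ℝ E]
  {M : Type*} [TopologicalSpace M] [ChartedSpace E M]

lemma mvfderiv_comp_apply {f : M → ℝ} {φ : ℝ → ℝ} {φ' : ℝ} {x : M} (hφ : HasDerivAt φ φ' (f x))
    (hf : ContMDiffAt 𝓘(ℝ, E) 𝓘(ℝ, ℝ) ∞ f x) (v : Tan E x) :
    mvfderiv 𝓘(ℝ, E) (fun y ↦ φ (f y)) x v = φ' * mvfderiv 𝓘(ℝ, E) f x v := by
  have h1 := (hf.mdifferentiableAt (by simp)).hasMFDerivAt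
  have h2 := (HasMFDerivAt.comp x hφ.hasFDerivAt.hasMFDerivAt h1).mfderiv
  have h3 : mvfderiv 𝓘(ℝ, E) (fun y ↦ φ (f y)) x v = mvfderiv 𝓘(ℝ, E) f x v * φ' :=
    congrArg (fun L : E →L[ℝ] ℝ ↦ L v) h2
  rw [mul_comm]
  exact h3

end Chain

namespace ConfAlmostHermitian

variable {E : Type*} [NormedAddCommGroup E] [NormedSpace ℝ E]
  {M : Type*} [TopologicalSpace M] [ChartedSpace E M] [IsManifold 𝓘(ℝ, E) ∞ M]
  (S : ConfAlmostHermitian E M) [FiniteDimensional ℝ E]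

lemma density_ne_zero (g : S.Gauge) (t : ℝ) (x : M) : g.1.density t x ≠ 0 :=
  (S.isHermitianTriple g x).metricDensity_ne_zero t

lemma eq_coord_smul (g : S.Gauge) {t : ℝ} (x : M) (s : Density t (Tan E x)) :
    s = Density.coord (g.1.density t x) s • g.1.density t x :=
  (S.isHermitianTriple g x).eq_coord_smul s

/-- The conformal factor of a metric in the class, with respect to the chosen one. -/
def factor (g : S.Gauge) (x : M) : ℝ :=
  (Density.coord (S.gauge.1.density 2 x) (g.1.density 2 x))⁻¹

lemma density_eq_smul (g : S.Gauge) (x : M) :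
    g.1.density 2 x = (S.factor g x)⁻¹ • S.gauge.1.density 2 x := by
  rw [factor, inv_inv]
  exact S.eq_coord_smul S.gauge x _

lemma factor_ne_zero (g : S.Gauge) (x : M) : S.factor g x ≠ 0 := by
  intro h
  have := S.density_eq_smul g x
  rw [h, inv_zero, zero_smul] at this
  exact S.density_ne_zero g 2 x this

/-- Both metrics represent the same `c`, so metric and density scale by inverse factors. -/
lemma inner_eq_factor_mul (g : S.Gauge) (x : M) (u v : Tan E x) :
    g.1.inner x u v = S.factor g x * S.gauge.1.inner x u v := by
  have h := (g.2 x u v).symm.trans (S.gauge.2 x u v)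
  rw [S.density_eq_smul g x, smul_smul] at h
  have h' : g.1.inner x u v * (S.factor g x)⁻¹ = S.gauge.1.inner x u v :=
    smul_left_injective ℝ (S.density_ne_zero S.gauge 2 x) h
  rw [← h', mul_comm, mul_assoc, inv_mul_cancel₀ (S.factor_ne_zero g x), mul_one]

variable (hdim : 4 ≤ Module.finrank ℝ E) [T2Space M]
include hdim

lemma contMDiff_factor (g : S.Gauge) : ContMDiff 𝓘(ℝ, E) 𝓘(ℝ, ℝ) ∞ (S.factor g) := by
  intro x
  have : Nontrivial (Tan E x) := Module.nontrivial_of_finrank_pos (R := ℝ) (M := E) (by omega)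
  obtain ⟨u, hu⟩ := exists_ne (0 : Tan E x)
  obtain ⟨X, hX, rfl⟩ := SmoothField.exists_eq u
  have h0 : S.gauge.1.inner x (X x) (X x) ≠ 0 := (S.gauge.1.pos x _ hu).ne'
  have h1 := S.gauge.1.contMDiff_inner hX hX x
  refine ((g.1.contMDiff_inner hX hX x).div₀ h1 h0).congr_of_eventuallyEq ?_
  filter_upwards [h1.continuousAt.eventually_ne h0] with y hy
  rw [Pi.div_apply, S.inner_eq_factor_mul, mul_div_cancel_right₀ _ hy]

lemma extD_fundForm_eq (g : S.Gauge) (x : M) :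
    (extD (S.fundForm g) x).toAlternatingMap =
      wedge (mvfderiv 𝓘(ℝ, E) (S.factor g) x).toLinearMap (S.fundForm S.gauge x).toAlternatingMap +
        S.factor g x • (extD (S.fundForm S.gauge) x).toAlternatingMap := by
  refine extD_smul_two (S.smoothFormAt_fundForm S.gauge x) (S.contMDiff_factor hdim g x)
    (Filter.Eventually.of_forall fun y ↦ ?_)
  ext v
  exact S.inner_eq_factor_mul g y _ _

/-- With `f` the factor, `d(f Ω) = df ∧ Ω + f dΩ`. Contraction for the scaled metric carries `f⁻¹`,
and that of `df ∧ Ω` gives `(n - 2) df`. -/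
lemma lee_eq (g : S.Gauge) (x : M) (u : Tan E x) :
    S.lee g x u = S.lee S.gauge x u +
      (S.factor g x)⁻¹ * mvfderiv 𝓘(ℝ, E) (S.factor g) x u := by
  have h := S.isHermitianTriple S.gauge x
  obtain ⟨e, he⟩ := h.exists_ON
  rw [S.lee_apply hdim g x e, S.lee_apply hdim S.gauge x e,
    contraction_of_eq_mul he (S.factor_ne_zero g x) (fun u v ↦ S.inner_eq_factor_mul g x u v),
    S.extD_fundForm_eq hdim, contraction_add_smul, contraction_wedge h he, Fintype.card_fin]
  have h1 := finrank_sub_two_ne_zero hdim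
  have h2 := S.factor_ne_zero g x
  change _ * (_ * (((Module.finrank ℝ E : ℝ) - 2) * mvfderiv 𝓘(ℝ, E) (S.factor g) x u + _)) = _
  field_simp
  ring

omit hdim [T2Space M] [FiniteDimensional ℝ E] in
lemma dFundForm₀_apply (g : S.Gauge) (x : M) (u v w : Tan E x) :
    S.dFundForm₀ g x ![u, v, w] = extD (S.fundForm g) x ![u, v, w] -
      (S.lee g x u * S.fundForm g x ![v, w] - S.lee g x v * S.fundForm g x ![u, w] +
        S.lee g x w * S.fundForm g x ![u, v]) := by
  rw [dFundForm₀, AlternatingMap.sub_apply, wedge_apply]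
  rfl

lemma dFundForm₀_eq (g : S.Gauge) (x : M) :
    S.dFundForm₀ g x = S.factor g x • S.dFundForm₀ S.gauge x := by
  refine alternating_three_ext fun u v w ↦ ?_
  have h2 := S.factor_ne_zero g x
  have hf : ∀ u v, S.fundForm g x ![u, v] = S.factor g x * S.fundForm S.gauge x ![u, v] :=
    fun u v ↦ S.inner_eq_factor_mul g x _ _
  have hd := congrArg (fun φ ↦ φ ![u, v, w]) (S.extD_fundForm_eq hdim g x)
  simp only [AlternatingMap.add_apply, wedge_apply] at hd
  change extD (S.fundForm g) x ![u, v, w] =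
    mvfderiv 𝓘(ℝ, E) (S.factor g) x u * S.fundForm S.gauge x ![v, w] -
    mvfderiv 𝓘(ℝ, E) (S.factor g) x v * S.fundForm S.gauge x ![u, w] +
    mvfderiv 𝓘(ℝ, E) (S.factor g) x w * S.fundForm S.gauge x ![u, v] +
    S.factor g x * extD (S.fundForm S.gauge) x ![u, v, w] at hd
  rw [AlternatingMap.smul_apply, dFundForm₀_apply, dFundForm₀_apply, hd, hf, hf, hf,
    S.lee_eq hdim g, S.lee_eq hdim g, S.lee_eq hdim g, smul_eq_mul]
  field_simp
  ring

lemma dFundForm₀_eq_zero_iff (g : S.Gauge) (x : M) :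
    S.dFundForm₀ g x = 0 ↔ S.dFundForm₀ S.gauge x = 0 := by
  rw [S.dFundForm₀_eq hdim, smul_eq_zero, or_iff_right (S.factor_ne_zero g x)]

/-- The two Lee forms differ by the exact form `d log |f|`. -/
lemma extD_leeForm_eq (g : S.Gauge) {X Y : (y : M) → Tan E y} (hX : SmoothField X)
    (hY : SmoothField Y) (x : M) :
    extD (S.leeForm g) x ![X x, Y x] = extD (S.leeForm S.gauge) x ![X x, Y x] := by
  -- `Real.log` is `log |·|`, so a nonvanishing factor suffices and its sign is not needed.
  let h : M → ℝ := fun y ↦ Real.log (S.factor g y)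
  have hh : ∀ y, ContMDiffAt 𝓘(ℝ, E) 𝓘(ℝ, ℝ) ∞ h y := fun y ↦
    (Real.contDiffAt_log.2 (S.factor_ne_zero g y)).contMDiffAt.comp y (S.contMDiff_factor hdim g y)
  have hl : ∀ y u, S.lee g y u = S.lee S.gauge y u + mvfderiv 𝓘(ℝ, E) h y u := by
    intro y u
    rw [S.lee_eq hdim, mvfderiv_comp_apply (Real.hasDerivAt_log (S.factor_ne_zero g y))
      (S.contMDiff_factor hdim g y)]
  rw [S.extD_leeForm_apply hdim g hX hY, S.extD_leeForm_apply hdim S.gauge hX hY]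
  simp only [hl]
  rw [mvfderiv_add_apply (S.contMDiffAt_lee hdim _ hY x) (contMDiffAt_mvfderiv (hh x) hY),
    mvfderiv_add_apply (S.contMDiffAt_lee hdim _ hX x) (contMDiffAt_mvfderiv (hh x) hX),
    mvfderiv_bracket (hh x) hX hY]
  ring

end ConfAlmostHermitian

/-! ### Koszul expressions, the Nijenhuis tensor and `d^∇ Ω`. -/

namespace ConfAlmostHermitian

open VectorField

variable {E : Type*} [NormedAddCommGroup E] [NormedSpace ℝ E]
  {M : Type*} [TopologicalSpace M] [ChartedSpace E M] [IsManifold 𝓘(ℝ, E) ∞ M]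
  (S : ConfAlmostHermitian E M)

/-- The derivative of a function, twisted by the Lee form of the chosen metric. -/
def twistedDeriv (f : M → ℝ) (x : M) (v : Tan E x) : ℝ :=
  mvfderiv 𝓘(ℝ, E) f x v - S.lee S.gauge x v * f x

/-- The inner product of vector fields with respect to the chosen metric. -/
def ip (X Y : (y : M) → Tan E y) (x : M) : ℝ := S.gauge.1.inner x (X x) (Y x)

lemma ip_comm (X Y : (y : M) → Tan E y) : S.ip X Y = S.ip Y X :=
  funext fun x ↦ S.gauge.1.symm x _ _

lemma ip_app_right (X Y : (y : M) → Tan E y) (x : M) :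
    S.ip X (S.J.app Y) x = -S.ip (S.J.app X) Y x :=
  S.inner_J_right S.gauge x _ _

lemma ip_app_app (X Y : (y : M) → Tan E y) : S.ip (S.J.app X) (S.J.app Y) = S.ip X Y :=
  funext fun x ↦ S.compatible S.gauge.1 S.gauge.2 x _ _

lemma twistedDeriv_ip_app_right (X Y : (y : M) → Tan E y) (x : M) (v : Tan E x) :
    S.twistedDeriv (S.ip X (S.J.app Y)) x v = -S.twistedDeriv (S.ip (S.J.app X) Y) x v := by
  have h : S.ip X (S.J.app Y) = fun y ↦ -S.ip (S.J.app X) Y y := funext (S.ip_app_right X Y)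
  rw [h, twistedDeriv, mvfderiv_neg_apply, twistedDeriv]
  ring

/-- The scalar six-terms expression. -/
def koszul (X Y Z : (y : M) → Tan E y) (x : M) : ℝ :=
  S.twistedDeriv (S.ip Y Z) x (X x) + S.twistedDeriv (S.ip X Z) x (Y x)
    - S.twistedDeriv (S.ip X Y) x (Z x)
    + S.ip (bracket X Y) Z x - S.ip (bracket X Z) Y x - S.ip (bracket Y Z) X x

/-- The scalar expression of `d^∇ Ω`. -/
def twistedDOmega (X Y Z : (y : M) → Tan E y) (x : M) : ℝ :=
  S.twistedDeriv (S.ip (S.J.app Y) Z) x (X x) - S.twistedDeriv (S.ip (S.J.app X) Z) x (Y x)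
    + S.twistedDeriv (S.ip (S.J.app X) Y) x (Z x)
    - S.ip (S.J.app (bracket X Y)) Z x + S.ip (S.J.app (bracket X Z)) Y x
    - S.ip (S.J.app (bracket Y Z)) X x

/-- The left side is `2 g((∇_X J) Y, Z)`. Since `J` is orthogonal, hence skew, the derivatives along
`X` cancel on each side. On the right, the brackets `[JY, JZ]` and `[Y, Z]` in the Nijenhuis term
cancel those in the two `d^∇ Ω` terms. -/
lemma koszul_add_koszul_app (X Y Z : (y : M) → Tan E y) (x : M) :
    S.koszul X (S.J.app Y) Z x + S.koszul X Y (S.J.app Z) x =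
      S.twistedDOmega X Y Z x - S.twistedDOmega X (S.J.app Y) (S.J.app Z) x
        + S.ip (S.J.nijenhuis Y Z) (S.J.app X) x := by
  have hN : S.ip (S.J.nijenhuis Y Z) (S.J.app X) x =
      S.ip (bracket (S.J.app Y) (S.J.app Z)) (S.J.app X) x - S.ip (bracket (S.J.app Y) Z) X x
        - S.ip (bracket Y (S.J.app Z)) X x - S.ip (bracket Y Z) (S.J.app X) x := by
    rw [← S.ip_app_app _ X, ← S.ip_app_app (bracket Y (S.J.app Z)) X]
    simp only [ip, AlmostComplex.nijenhuis, Pi.sub_apply, map_sub, sub_apply]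
  rw [hN]
  simp only [koszul, twistedDOmega, ip_app_app]
  simp only [twistedDeriv_ip_app_right, ip_app_right]
  ring

/-- For a torsion-free connection `d^∇ Ω` is the alternation of `∇Ω`; this is the scalar form of
that fact, free of the Nijenhuis tensor. -/
lemma cyclic_koszul (X Y Z : (y : M) → Tan E y) (x : M) :
    (S.koszul X (S.J.app Y) Z x + S.koszul X Y (S.J.app Z) x) +
    (S.koszul Y (S.J.app Z) X x + S.koszul Y Z (S.J.app X) x) +
    (S.koszul Z (S.J.app X) Y x + S.koszul Z X (S.J.app Y) x) = 2 * S.twistedDOmega X Y Z x := by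
  have hb : ∀ V W U : (y : M) → Tan E y,
      S.ip (bracket V W) U x = -S.ip (bracket W V) U x := fun V W U ↦ by
    rw [bracket, mlieBracket_swap]
    simp only [ip, Pi.neg_apply, map_neg, neg_apply]
  have hs : ∀ V W : (y : M) → Tan E y, ∀ v : Tan E x,
      S.twistedDeriv (S.ip (S.J.app V) W) x v = -S.twistedDeriv (S.ip (S.J.app W) V) x v :=
    fun V W v ↦ by rw [S.ip_comm, twistedDeriv_ip_app_right]
  simp only [koszul, twistedDOmega, twistedDeriv_ip_app_right]
  rw [hs Z Y, hs Z X, hs Y X, S.ip_comm Z X, S.ip_comm Z Y, S.ip_comm Y X]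
  -- Every `J` moves to the second slot, so the bracket terms match up to antisymmetry.
  simp only [← neg_eq_iff_eq_neg.2 (S.ip_app_right _ _ x)]
  linarith [hb Z (S.J.app Y) X, hb X (S.J.app Z) Y, hb Y (S.J.app X) Z, hb Y X (S.J.app Z),
    hb Z Y (S.J.app X), hb Z X (S.J.app Y)]

/-- The Koszul expression is tensorial in `Z`, hence a covector at `x`, represented by a vector
through the metric. This existence makes the choice defining `nabla` meaningful. -/
lemma exists_koszul_eq [FiniteDimensional ℝ E] {X Y : (y : M) → Tan E y} (hX : SmoothField X)
    (hY : SmoothField Y) (x : M) :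
    ∃ v : Tan E x, ∀ Z, SmoothField Z → 2 * S.gauge.1.inner x v (Z x) = S.koszul X Y Z x := by
  have hM2 : IsManifold 𝓘(ℝ, E) (minSmoothness ℝ 2) M := by
    rw [minSmoothness_of_isRCLikeNormedField]; infer_instance
  have hM1 : IsManifold 𝓘(ℝ, E) 1 M := IsManifold.of_le (n := ∞) (by simp)
  -- The tensoriality criterion tests functions and sections that are only differentiable at `x`, so
  -- smoothness of the inner product on smooth fields is not enough.
  have hip : ∀ {V W : (y : M) → Tan E y},
      MDifferentiableAt 𝓘(ℝ, E) 𝓘(ℝ, E).tangent (fun y ↦ (⟨y, V y⟩ : TangentBundle 𝓘(ℝ, E) M)) x →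
      MDifferentiableAt 𝓘(ℝ, E) 𝓘(ℝ, E).tangent (fun y ↦ (⟨y, W y⟩ : TangentBundle 𝓘(ℝ, E) M)) x →
      MDifferentiableAt 𝓘(ℝ, E) 𝓘(ℝ, ℝ) (S.ip V W) x := by
    intro V W hV hW
    have h := MDifferentiableAt.clm_bundle_apply₂ (F₁ := E) (F₂ := E) (F₃ := ℝ) (b := fun y : M ↦ y)
      (E₁ := fun y : M ↦ TangentSpace 𝓘(ℝ, E) y) (E₂ := fun y : M ↦ TangentSpace 𝓘(ℝ, E) y)
      (E₃ := Bundle.Trivial M ℝ) ((S.gauge.1.contMDiff x).mdifferentiableAt (by simp)) hV hW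
    rw [mdifferentiableAt_section] at h
    exact h
  have hX' := (hX x).mdifferentiableAt (by simp)
  have hY' := (hY x).mdifferentiableAt (by simp)
  have hT : TensorialAt 𝓘(ℝ, E) E (V := fun y : M ↦ TangentSpace 𝓘(ℝ, E) y)
      (fun Z ↦ S.koszul X Y Z x) x := by
    constructor
    -- The terms `(X f) g(Y, Z)` and `(Y f) g(X, Z)` from the product rule cancel those from `[X, f
    -- Z]` and `[Y, f Z]`.
    · intro f Z hf hZ
      have h1 : ∀ W : (y : M) → Tan E y, S.ip W (f • Z) = fun y ↦ f y * S.ip W Z y := fun W ↦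
        funext fun y ↦ map_smul (S.gauge.1.inner y (W y)) (f y) (Z y)
      have h2 : ∀ {W : (y : M) → Tan E y}, MDifferentiableAt 𝓘(ℝ, E) 𝓘(ℝ, E).tangent
          (fun y ↦ (⟨y, W y⟩ : TangentBundle 𝓘(ℝ, E) M)) x → ∀ v,
          S.twistedDeriv (S.ip W (f • Z)) x v =
            f x * S.twistedDeriv (S.ip W Z) x v + S.ip W Z x * mvfderiv 𝓘(ℝ, E) f x v := by
        intro W hW v
        rw [twistedDeriv, twistedDeriv, h1, mvfderiv_fun_mul hf (hip hW hZ)]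
        simp only [add_apply, smul_apply, smul_eq_mul]
        ring
      have h3 : ∀ V W : (y : M) → Tan E y, S.ip (bracket V (f • Z)) W x =
          mvfderiv 𝓘(ℝ, E) f x (V x) * S.ip Z W x + f x * S.ip (bracket V Z) W x := by
        intro V W
        simp only [ip, mlieBracket_smul_right hf hZ, map_add, map_smul, add_apply, smul_apply,
          smul_eq_mul]
      have h4 : S.twistedDeriv (S.ip X Y) x ((f • Z) x) =
          f x * S.twistedDeriv (S.ip X Y) x (Z x) := by
        rw [Pi.smul_apply', twistedDeriv, twistedDeriv, map_smul, map_smul, smul_eq_mul,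
          smul_eq_mul]
        ring
      rw [koszul, h2 hY', h2 hX', h3, h3, h4, h1, koszul, smul_eq_mul, S.ip_comm Z Y,
        S.ip_comm Z X]
      ring
    · intro Z Z' hZ hZ'
      have h1 : ∀ W : (y : M) → Tan E y, S.ip W (Z + Z') = fun y ↦ S.ip W Z y + S.ip W Z' y :=
        fun W ↦ funext fun y ↦ map_add (S.gauge.1.inner y (W y)) (Z y) (Z' y)
      have h2 : ∀ {W : (y : M) → Tan E y}, MDifferentiableAt 𝓘(ℝ, E) 𝓘(ℝ, E).tangent
          (fun y ↦ (⟨y, W y⟩ : TangentBundle 𝓘(ℝ, E) M)) x → ∀ v,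
          S.twistedDeriv (S.ip W (Z + Z')) x v =
            S.twistedDeriv (S.ip W Z) x v + S.twistedDeriv (S.ip W Z') x v := by
        intro W hW v
        rw [twistedDeriv, twistedDeriv, twistedDeriv, h1, mvfderiv_fun_add (hip hW hZ) (hip hW hZ')]
        simp only [add_apply]
        ring
      have h3 : ∀ V W : (y : M) → Tan E y, S.ip (bracket V (Z + Z')) W x =
          S.ip (bracket V Z) W x + S.ip (bracket V Z') W x := by
        intro V W
        simp only [ip, mlieBracket_add_right hZ hZ', map_add, add_apply]
      have h4 : S.twistedDeriv (S.ip X Y) x ((Z + Z') x) =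
          S.twistedDeriv (S.ip X Y) x (Z x) + S.twistedDeriv (S.ip X Y) x (Z' x) := by
        rw [Pi.add_apply, twistedDeriv, twistedDeriv, twistedDeriv, map_add, map_add]
        ring
      rw [koszul, h2 hY', h2 hX', h3, h3, h4, h1, koszul, koszul]
      ring
  let φ : Tan E x →L[ℝ] ℝ := TensorialAt.mkHom _ x hT
  have hφ : ∀ Z, SmoothField Z → φ (Z x) = S.koszul X Y Z x := fun Z hZ ↦
    TensorialAt.mkHom_apply hT ((hZ x).mdifferentiableAt (by simp))
  obtain ⟨e, he⟩ := (S.isHermitianTriple S.gauge x).exists_ON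
  refine ⟨(2⁻¹ : ℝ) • ∑ i, φ (e i) • e i, fun Z hZ ↦ ?_⟩
  rw [← hφ Z hZ]
  have h1 : S.gauge.1.inner x (∑ i, φ (e i) • e i) (Z x) = φ (Z x) := by
    conv_rhs => rw [← he.sum_repr (Z x)]
    rw [S.gauge.1.symm]
    simp only [map_sum, map_smul, smul_eq_mul]
    exact Finset.sum_congr rfl fun i _ ↦ mul_comm _ _
  rw [map_smul, smul_apply, h1, smul_eq_mul, mul_inv_cancel_left₀ two_ne_zero]

end ConfAlmostHermitian

/-! ### The Weyl connection, preservation of `J`, and curvature of `L²_M`. -/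

namespace ConfAlmostHermitian

variable {E : Type*} [NormedAddCommGroup E] [NormedSpace ℝ E]
  {M : Type*} [TopologicalSpace M] [ChartedSpace E M] [IsManifold 𝓘(ℝ, E) ∞ M]
  (S : ConfAlmostHermitian E M)

lemma pair_eq (X Y : (y : M) → Tan E y) :
    S.pair X Y = fun y ↦ S.ip X Y y • S.gauge.1.density 2 y :=
  funext fun y ↦ S.gauge.2 y (X y) (Y y)

variable [FiniteDimensional ℝ E]

lemma nablaL_smul (X : (y : M) → Tan E y) (f : M → ℝ) :
    S.nablaL X (fun y ↦ f y • S.gauge.1.density 2 y) =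
      fun x ↦ S.twistedDeriv f x (X x) • S.gauge.1.density 2 x := by
  funext x
  rw [nablaL, twistedDeriv]
  simp only [Density.coord_smul (S.density_ne_zero S.gauge 2 _)]
  rw [div_self (two_ne_zero), one_mul]

lemma nablaL_pair (X Y Z : (y : M) → Tan E y) (x : M) :
    S.nablaL X (S.pair Y Z) x = S.twistedDeriv (S.ip Y Z) x (X x) • S.gauge.1.density 2 x := by
  rw [pair_eq, nablaL_smul]

lemma sixTerms_apply (X Y Z : (y : M) → Tan E y) (x : M) :
    S.sixTerms X Y Z x = S.koszul X Y Z x • S.gauge.1.density 2 x := by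
  have h : ∀ (V : Type _) [AddCommGroup V] [Module ℝ V] (a₁ a₂ a₃ a₄ a₅ a₆ : ℝ) (l : V),
      a₁ • l + a₂ • l - a₃ • l + a₄ • l - a₅ • l - a₆ • l = (a₁ + a₂ - a₃ + a₄ - a₅ - a₆) • l := by
    intros
    module
  simp only [sixTerms, koszul, Pi.add_apply, Pi.sub_apply, nablaL_pair]
  simp only [pair_eq]
  exact h _ _ _ _ _ _ _ _

lemma dNablaOmega_apply (X Y Z : (y : M) → Tan E y) (x : M) :
    S.dNablaOmega X Y Z x = S.twistedDOmega X Y Z x • S.gauge.1.density 2 x := by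
  have h : ∀ (V : Type _) [AddCommGroup V] [Module ℝ V] (a₁ a₂ a₃ a₄ a₅ a₆ : ℝ) (l : V),
      a₁ • l - a₂ • l + a₃ • l - a₄ • l + a₅ • l - a₆ • l = (a₁ - a₂ + a₃ - a₄ + a₅ - a₆) • l := by
    intros
    module
  simp only [dNablaOmega, twistedDOmega, Omega, Pi.add_apply, Pi.sub_apply, nablaL_pair]
  simp only [pair_eq]
  exact h _ _ _ _ _ _ _ _

lemma two_mul_inner_nabla {X Y Z : (y : M) → Tan E y} (hX : SmoothField X) (hY : SmoothField Y)
    (hZ : SmoothField Z) (x : M) :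
    2 * S.gauge.1.inner x (S.nabla X Y x) (Z x) = S.koszul X Y Z x := by
  have key : ∀ (v : Tan E x) (Z : (y : M) → Tan E y),
      (2 : ℝ) • S.c.toFun x v (Z x) = S.sixTerms X Y Z x ↔
        2 * S.gauge.1.inner x v (Z x) = S.koszul X Y Z x := by
    intro v Z
    rw [sixTerms_apply, S.gauge.2, smul_smul]
    exact (smul_left_injective ℝ (S.density_ne_zero S.gauge 2 x)).eq_iff
  obtain ⟨v, hv⟩ := S.exists_koszul_eq hX hY x
  refine (key _ Z).1 (Classical.epsilon_spec (p := fun v : Tan E x ↦ ∀ Z : (x : M) → Tan E x,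
    SmoothField Z → (2 : ℝ) • S.c.toFun x v (Z x) = S.sixTerms X Y Z x)
    ⟨v, fun Z hZ ↦ (key v Z).2 (hv Z hZ)⟩ Z hZ)

variable [T2Space M]

lemma eq_of_forall_inner_eq {x : M} {u v : Tan E x} (h : ∀ Z, SmoothField Z →
    S.gauge.1.inner x u (Z x) = S.gauge.1.inner x v (Z x)) : u = v := by
  by_contra huv
  have h0 : u - v ≠ 0 := sub_ne_zero.2 huv
  obtain ⟨Z, hZ, hZx⟩ := SmoothField.exists_eq (u - v)
  have h1 := S.gauge.1.pos x _ h0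
  have h2 : S.gauge.1.inner x (u - v) (Z x) =
      S.gauge.1.inner x u (Z x) - S.gauge.1.inner x v (Z x) := by
    rw [map_sub, sub_apply]
  rw [hZx, ← hZx, h Z hZ, sub_self, hZx] at h2
  exact h1.ne' h2

/-- Skewness of `J` turns `g(∇_X Y, J Z)` into `-g(J ∇_X Y, Z)`, so the sum is `2 g((∇_X J) Y, Z)`.
-/
lemma preservesJ_iff_koszul : S.PreservesJ ↔ ∀ X Y Z : (y : M) → Tan E y, SmoothField X →
    SmoothField Y → SmoothField Z → ∀ x,
      S.koszul X (S.J.app Y) Z x + S.koszul X Y (S.J.app Z) x = 0 := by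
  have key : ∀ X Y Z : (y : M) → Tan E y, SmoothField X → SmoothField Y → SmoothField Z → ∀ x,
      S.koszul X (S.J.app Y) Z x + S.koszul X Y (S.J.app Z) x =
        2 * S.gauge.1.inner x (S.nabla X (S.J.app Y) x) (Z x) -
          2 * S.gauge.1.inner x (S.J.app (S.nabla X Y) x) (Z x) := by
    intro X Y Z hX hY hZ x
    rw [← S.two_mul_inner_nabla hX (S.J.smoothField_app hY) hZ,
      ← S.two_mul_inner_nabla hX hY (S.J.smoothField_app hZ)]
    have h1 : S.gauge.1.inner x (S.nabla X Y x) (S.J.app Z x) =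
        -S.gauge.1.inner x (S.J.app (S.nabla X Y) x) (Z x) := S.inner_J_right S.gauge x _ _
    rw [h1]
    ring
  constructor
  · intro h X Y Z hX hY hZ x
    rw [key X Y Z hX hY hZ, h X Y hX hY, sub_self]
  · intro h X Y hX hY
    funext x
    refine S.eq_of_forall_inner_eq fun Z hZ ↦ ?_
    have := h X Y Z hX hY hZ x
    rw [key X Y Z hX hY hZ] at this
    linarith

/-- The untwisted terms form the invariant formula for `dΩ`; the Lee terms are `-ω ∧ Ω`. -/
lemma twistedDOmega_eq {X Y Z : (y : M) → Tan E y} (hX : SmoothField X) (hY : SmoothField Y)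
    (hZ : SmoothField Z) (x : M) :
    S.twistedDOmega X Y Z x = S.dFundForm₀ S.gauge x ![X x, Y x, Z x] := by
  rw [dFundForm₀_apply, extD_apply_two (S.smoothFormAt_fundForm S.gauge x) hX hY hZ]
  simp only [twistedDOmega, twistedDeriv]
  have h : ∀ V W : (y : M) → Tan E y,
      S.ip (S.J.app V) W = fun y ↦ S.fundForm S.gauge y ![V y, W y] := fun _ _ ↦ rfl
  simp only [h]
  ring

lemma forall_twistedDOmega_eq_zero_iff :
    (∀ X Y Z : (y : M) → Tan E y, SmoothField X → SmoothField Y → SmoothField Z → ∀ x,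
      S.twistedDOmega X Y Z x = 0) ↔ ∀ x, S.dFundForm₀ S.gauge x = 0 := by
  constructor
  · intro h x
    refine alternating_three_ext fun u v w ↦ ?_
    obtain ⟨X, hX, rfl⟩ := SmoothField.exists_eq u
    obtain ⟨Y, hY, rfl⟩ := SmoothField.exists_eq v
    obtain ⟨Z, hZ, rfl⟩ := SmoothField.exists_eq w
    rw [← S.twistedDOmega_eq hX hY hZ, h X Y Z hX hY hZ]
    rfl
  · intro h X Y Z hX hY hZ x
    rw [S.twistedDOmega_eq hX hY hZ, h]
    rfl

lemma omegaClosed_iff : S.OmegaClosed ↔ ∀ x, S.dFundForm₀ S.gauge x = 0 := by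
  rw [← forall_twistedDOmega_eq_zero_iff]
  refine forall₃_congr fun X Y Z ↦ forall₃_congr fun _ _ _ ↦ ?_
  rw [funext_iff]
  refine forall_congr' fun x ↦ ?_
  rw [dNablaOmega_apply]
  exact smul_eq_zero_iff_left (S.density_ne_zero S.gauge 2 x)

/-- The canonical Weyl connection preserves `J` if and only if `J` is integrable and the trace-free
part of `dΩ_g` vanishes. -/
theorem preservesJ_iff (hdim : 4 ≤ Module.finrank ℝ E) (g : S.Gauge) :
    S.PreservesJ ↔ S.J.Integrable ∧ ∀ x, S.dFundForm₀ g x = 0 := by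
  rw [forall_congr' fun x ↦ S.dFundForm₀_eq_zero_iff hdim g x, preservesJ_iff_koszul,
    ← forall_twistedDOmega_eq_zero_iff]
  constructor
  · intro h
    have hD : ∀ X Y Z : (y : M) → Tan E y, SmoothField X → SmoothField Y → SmoothField Z → ∀ x,
        S.twistedDOmega X Y Z x = 0 := by
      intro X Y Z hX hY hZ x
      have := S.cyclic_koszul X Y Z x
      rw [h X Y Z hX hY hZ, h Y Z X hY hZ hX, h Z X Y hZ hX hY] at this
      linarith
    refine ⟨fun X Y hX hY x _ ↦ S.eq_of_forall_inner_eq fun Z hZ ↦ ?_, hD⟩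
    -- With `J Z` in the first slot, `J (J Z) = -Z` pairs the Nijenhuis tensor with an arbitrary
    -- field.
    have h1 := S.koszul_add_koszul_app (S.J.app Z) X Y x
    have hJZ := S.J.smoothField_app hZ
    rw [h _ X Y hJZ hX hY, hD _ X Y hJZ hX hY,
      hD _ _ _ hJZ (S.J.smoothField_app hX) (S.J.smoothField_app hY), sub_self, zero_add] at h1
    have h2 : S.J.app (S.J.app Z) x = -Z x := S.J.sq x _
    rw [ip, h2, map_neg, zero_eq_neg] at h1
    rw [h1, map_zero]
    rfl
  · rintro ⟨hN, hD⟩ X Y Z hX hY hZ x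
    rw [koszul_add_koszul_app, hD X Y Z hX hY hZ,
      hD X _ _ hX (S.J.smoothField_app hY) (S.J.smoothField_app hZ), ip,
      hN Y Z hY hZ x (Set.mem_univ x), map_zero]
    simp

variable (hdim : 4 ≤ Module.finrank ℝ E)
include hdim

/-- In the commutator of twisted derivatives the terms symmetric in `X`, `Y` cancel, and the second
derivatives of `f` cancel against the bracket term. What remains is `f dω`. -/
lemma curvL_smul {X Y : (y : M) → Tan E y} (hX : SmoothField X) (hY : SmoothField Y)
    {f : M → ℝ} (hf : ContMDiff 𝓘(ℝ, E) 𝓘(ℝ, ℝ) ∞ f) (x : M) :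
    S.curvL X Y (fun y ↦ f y • S.gauge.1.density 2 y) x =
      (f x * extD (S.leeForm S.gauge) x ![X x, Y x]) • S.gauge.1.density 2 x := by
  have key : ∀ {V : (y : M) → Tan E y}, SmoothField V → ∀ v : Tan E x,
      S.twistedDeriv (fun y ↦ S.twistedDeriv f y (V y)) x v =
        mvfderiv 𝓘(ℝ, E) (fun y ↦ mvfderiv 𝓘(ℝ, E) f y (V y)) x v
          - (S.lee S.gauge x (V x) * mvfderiv 𝓘(ℝ, E) f x v +
            f x * mvfderiv 𝓘(ℝ, E) (fun y ↦ S.lee S.gauge y (V y)) x v)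
          - S.lee S.gauge x v * (mvfderiv 𝓘(ℝ, E) f x (V x) - S.lee S.gauge x (V x) * f x) := by
    intro V hV v
    have h1 := S.contMDiffAt_lee hdim S.gauge hV x
    rw [← mvfderiv_mul_apply h1 (hf x),
      ← mvfderiv_sub_apply (f := fun y ↦ mvfderiv 𝓘(ℝ, E) f y (V y))
        (g := fun y ↦ S.lee S.gauge y (V y) * f y) (contMDiffAt_mvfderiv (hf x) hV) (h1.mul (hf x))]
    rfl
  have h : ∀ (V : Type _) [AddCommGroup V] [Module ℝ V] (a b c : ℝ) (l : V),
      a • l - (b • l - c • l) = (a - (b - c)) • l := by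
    intros
    module
  simp only [curvL, Pi.sub_apply, nablaL_smul]
  refine (h _ _ _ _ _).trans ?_
  congr 1
  rw [key hX, key hY, S.extD_leeForm_apply hdim _ hX hY, twistedDeriv,
    mvfderiv_bracket (hf x) hX hY]
  ring

theorem curvL_density (g : S.Gauge) {X Y : (y : M) → Tan E y} (hX : SmoothField X)
    (hY : SmoothField Y) (x : M) :
    S.curvL X Y (g.1.density 2) x =
      extD (S.leeForm g) x ![X x, Y x] • g.1.density 2 x := by
  have h1 : g.1.density 2 = fun y ↦ (S.factor g y)⁻¹ • S.gauge.1.density 2 y :=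
    funext fun y ↦ S.density_eq_smul g y
  have h2 : ContMDiff 𝓘(ℝ, E) 𝓘(ℝ, ℝ) ∞ (fun y ↦ (S.factor g y)⁻¹) := fun y ↦
    (contDiffAt_inv ℝ (S.factor_ne_zero g y)).contMDiffAt.comp y (S.contMDiff_factor hdim g y)
  rw [h1, S.curvL_smul hdim hX hY h2, S.extD_leeForm_eq hdim g hX hY, smul_smul, mul_comm]

omit hdim [T2Space M] in
/-- The value of the density of the chosen metric on a smooth frame is smooth and positive. -/
lemma contMDiffAt_density_ιMulti {X : Fin (Module.finrank ℝ E) → (y : M) → Tan E y}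
    (hX : ∀ i, SmoothField (X i)) {x : M} (hli : LinearIndependent ℝ (fun i ↦ X i x)) :
    ∃ m : M → ℝ, ContMDiffAt 𝓘(ℝ, E) 𝓘(ℝ, ℝ) ∞ m x ∧ m x ≠ 0 ∧
      ∀ᶠ y in 𝓝 x, (S.gauge.1.density 2 y : _ → ℝ)
        (exteriorPower.ιMulti ℝ (Module.finrank ℝ (Tan E y)) (fun i ↦ X i y)) = m y := by
  obtain ⟨e, he⟩ := (S.isHermitianTriple S.gauge x).exists_ON
  have hdet : ContMDiffAt 𝓘(ℝ, E) 𝓘(ℝ, ℝ) ∞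
      (fun y ↦ (gram (S.gauge.1.bilin y) (fun k ↦ X k y)).det) x :=
    contMDiffAt_det fun i j ↦ S.gauge.1.contMDiff_inner (hX i) (hX j) x
  have h0 : 0 < (gram (S.gauge.1.bilin x) (fun k ↦ X k x)).det :=
    he.gram_det_pos _ hli (by simp)
  have hφ : ContDiffAt ℝ ∞ (fun a : ℝ ↦ Real.sqrt a ^ (-2 / (Module.finrank ℝ E : ℝ)))
      (gram (S.gauge.1.bilin x) (fun k ↦ X k x)).det :=
    (contDiffAt_id.sqrt h0.ne').rpow_const_of_ne (Real.sqrt_pos.2 h0).ne'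
  refine ⟨_, hφ.contMDiffAt.comp x hdet, ?_, ?_⟩
  · exact (Real.rpow_pos_of_pos (Real.sqrt_pos.2 h0) _).ne'
  · filter_upwards [hdet.continuousAt.eventually_const_lt h0] with y hy
    exact metricDensity_ιMulti 2 (fun k ↦ X k y) hy

omit hdim in
/-- The coordinate of a density with respect to the density of the chosen metric is smooth if and
only if the density is. -/
lemma smoothDensity_smul_iff (f : M → ℝ) :
    SmoothDensity (fun y ↦ f y • S.gauge.1.density 2 y) ↔ ContMDiff 𝓘(ℝ, E) 𝓘(ℝ, ℝ) ∞ f := by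
  constructor
  · intro h x
    obtain ⟨e, -⟩ := (S.isHermitianTriple S.gauge x).exists_ON
    choose X hX hXe using fun i ↦ SmoothField.exists_eq (e i)
    have hli : LinearIndependent ℝ (fun i ↦ X i x) := by
      rw [show (fun i ↦ X i x) = e from funext hXe]
      exact e.linearIndependent
    obtain ⟨m, hm, hm0, hmX⟩ := S.contMDiffAt_density_ιMulti hX hli
    refine ((h X hX x hli).div₀ hm hm0).congr_of_eventuallyEq ?_
    filter_upwards [hmX, hm.continuousAt.eventually_ne hm0] with y hy hy0
    rw [Pi.div_apply, eq_div_iff hy0, ← hy]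
    rfl
  · intro hf X hX x hli
    obtain ⟨m, hm, -, hmX⟩ := S.contMDiffAt_density_ιMulti hX hli
    refine ((hf x).mul hm).congr_of_eventuallyEq ?_
    filter_upwards [hmX] with y hy
    change f y * _ = f y * m y
    rw [← hy]

/-- Testing on the metric density gives one direction. For the other, every smooth section is a
smooth function times that density. -/
lemma isFlat_iff : S.IsFlat ↔ ∀ X Y : (y : M) → Tan E y, SmoothField X → SmoothField Y →
    ∀ x, extD (S.leeForm S.gauge) x ![X x, Y x] = 0 := by
  constructor
  · intro h X Y hX hY x
    have h1 := (S.smoothDensity_smul_iff (fun _ ↦ 1)).2 contMDiff_const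
    have h2 := S.curvL_smul hdim hX hY (f := fun _ ↦ 1) contMDiff_const x
    rw [h X Y hX hY _ h1, one_mul] at h2
    exact (smul_eq_zero_iff_left (S.density_ne_zero S.gauge 2 x)).1 h2.symm
  · intro h X Y hX hY s hs
    have h1 : s = fun y ↦ Density.coord (S.gauge.1.density 2 y) (s y) • S.gauge.1.density 2 y :=
      funext fun y ↦ S.eq_coord_smul S.gauge y (s y)
    rw [h1] at hs ⊢
    funext x
    rw [S.curvL_smul hdim hX hY ((S.smoothDensity_smul_iff _).1 hs), h X Y hX hY, mul_zero,
      zero_smul]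
    rfl

end ConfAlmostHermitian

/-! ### The Poincaré lemma on a chart ball. -/

section Poincare

open VectorField

variable {E : Type*} [NormedAddCommGroup E] [NormedSpace ℝ E] [FiniteDimensional ℝ E]
  {M : Type*} [TopologicalSpace M] [ChartedSpace E M] [IsManifold 𝓘(ℝ, E) ∞ M]

/-- Fields with constant components in a chart commute. -/
lemma bracket_eq_zero_of_chartField_eq {x₀ : M} {y : E} (hy : y ∈ (extChartAt 𝓘(ℝ, E) x₀).target)
    {X Y : (z : M) → Tan E z} (hX : SmoothField X) (hY : SmoothField Y) {u v : E}
    (hu : ∀ᶠ z in 𝓝 y, chartField x₀ X z = u) (hv : ∀ᶠ z in 𝓝 y, chartField x₀ Y z = v) :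
    bracket X Y ((extChartAt 𝓘(ℝ, E) x₀).symm y) = 0 := by
  have hM2 : IsManifold 𝓘(ℝ, E) (minSmoothness ℝ 3) M := by
    rw [minSmoothness_of_isRCLikeNormedField]
    exact IsManifold.of_le (n := ∞) ENat.LEInfty.out
  have h1 : chartField x₀ (bracket X Y) y =
      lieBracket ℝ (chartField x₀ X) (chartField x₀ Y) y := by
    refine (mpullback_mlieBracket (n := ∞) ((hX _).mdifferentiableAt (by simp))
      ((hY _).mdifferentiableAt (by simp)) (contMDiffAt_extChartAt_symm hy)
      (by rw [minSmoothness_of_isRCLikeNormedField]; exact ENat.LEInfty.out)).trans ?_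
    rw [← mlieBracketWithin_univ, mlieBracketWithin_eq_lieBracketWithin, ← lieBracketWithin_univ]
    rfl
  have h2 : lieBracket ℝ (chartField x₀ X) (chartField x₀ Y) y = 0 := by
    have hu' : chartField x₀ X =ᶠ[𝓝 y] fun _ ↦ u := hu
    have hv' : chartField x₀ Y =ᶠ[𝓝 y] fun _ ↦ v := hv
    rw [lieBracket, hu'.fderiv_eq, hv'.fderiv_eq]
    simp
  rw [← mfderiv_extChartAt_symm_chartField hy (bracket X Y), h1, h2]
  exact map_zero _

/-- The Poincaré lemma for forms of degree one. -/
lemma exists_mvfderiv_eq [T2Space M] {η : Form E M 1} (hη : ∀ x, SmoothFormAt η x)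
    (hd : ∀ X Y : (x : M) → Tan E x, SmoothField X → SmoothField Y → ∀ x,
      extD η x ![X x, Y x] = 0) (x₀ : M) :
    ∃ U : Set M, IsOpen U ∧ x₀ ∈ U ∧ ∃ β : M → ℝ, ContMDiffOn 𝓘(ℝ, E) 𝓘(ℝ, ℝ) ∞ β U ∧
      ∀ x ∈ U, ∀ v, mvfderiv 𝓘(ℝ, E) β x v = η x ![v] := by
  set φ := extChartAt 𝓘(ℝ, E) x₀ with hφ
  let θ : E → E →L[ℝ] ℝ := fun y ↦
    (ContinuousAlternatingMap.ofSubsingletonLIE (𝕜 := ℝ) (E := E) (F := ℝ) (0 : Fin 1)).symm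
      (chartForm x₀ η y)
  obtain ⟨r, hr, hball⟩ := Metric.mem_nhds_iff.1
    ((isOpen_extChartAt_target x₀).mem_nhds (mem_extChartAt_target (I := 𝓘(ℝ, E)) x₀))
  set B := Metric.ball (φ x₀) r with hB
  have hθs : ∀ y ∈ φ.target, ContDiffAt ℝ ∞ θ y := by
    intro y hy
    have h1 := (hη (φ.symm y)).contDiffAt_chartForm (φ.map_target hy)
    rw [← hφ, φ.right_inv hy] at h1
    exact (ContinuousAlternatingMap.ofSubsingletonLIE (𝕜 := ℝ) (E := E) (F := ℝ)
      (0 : Fin 1)).symm.toContinuousLinearEquiv.contDiff.contDiffAt.comp y h1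
  have hθX : ∀ y ∈ φ.target, ∀ X : (x : M) → Tan E x,
      θ y (chartField x₀ X y) = η (φ.symm y) ![X (φ.symm y)] := by
    intro y hy X
    refine Eq.trans ?_ ((chartForm_chartField hy η (fun _ ↦ X)).trans ?_)
    · rfl
    · exact congrArg _ (by ext i; fin_cases i; rfl)
  have hsX : ∀ {X : (x : M) → Tan E x}, SmoothField X → ∀ x,
      ContMDiffAt 𝓘(ℝ, E) 𝓘(ℝ, ℝ) ∞ (fun y ↦ η y ![X y]) x := by
    intro X hX x
    refine (hη x (fun _ ↦ X) (fun _ ↦ hX)).congr_of_eventuallyEq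
      (Filter.Eventually.of_forall fun y ↦ congrArg (η y) (by ext i; fin_cases i; rfl))
  -- `extD` at a point uses the chart around that point, not the fixed chart at `x₀`. The invariant
  -- formula on commuting fields, constant in the fixed chart near `y`, carries closedness over.
  have hsymm : ∀ y ∈ B, ∀ u v, fderiv ℝ θ y u v = fderiv ℝ θ y v u := by
    intro y hyB u v
    have hy := hball hyB
    obtain ⟨X, hX, hXu⟩ := SmoothField.exists_chartField_eq (φ.map_target hy) u
    obtain ⟨Y, hY, hYv⟩ := SmoothField.exists_chartField_eq (φ.map_target hy) v
    rw [← hφ, φ.right_inv hy] at hXu hYv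
    have key : ∀ {X Y : (x : M) → Tan E x} {u v : E}, SmoothField Y →
        (∀ᶠ z in 𝓝 y, chartField x₀ X z = u) → (∀ᶠ z in 𝓝 y, chartField x₀ Y z = v) →
        fderiv ℝ θ y u v =
          mvfderiv 𝓘(ℝ, E) (fun z ↦ η z ![Y z]) (φ.symm y) (X (φ.symm y)) := by
      intro X Y u v hY hu hv
      rw [← fderiv_comp_extChartAt_symm hy ((hsX hY _).mdifferentiableAt (by simp)),
        hu.self_of_nhds]
      have h1 : (fun z ↦ η z ![Y z]) ∘ φ.symm =ᶠ[𝓝 y] fun z ↦ θ z v := by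
        filter_upwards [hv, (isOpen_extChartAt_target x₀).mem_nhds hy] with z hz hzt
        rw [← hz, hθX z hzt]
        rfl
      rw [h1.fderiv_eq, fderiv_clm_apply ((hθs y hy).differentiableAt (by simp))
        (differentiableAt_const v)]
      simp
    rw [key hY hXu hYv, key hX hYv hXu, ← sub_eq_zero]
    have h1 := hd X Y hX hY (φ.symm y)
    rw [extD_apply_one (hη _) hX hY, bracket_eq_zero_of_chartField_eq hy hX hY hXu hYv] at h1
    have h2 : η (φ.symm y) ![0] = 0 :=
      (η (φ.symm y)).map_coord_zero (0 : Fin 1) rfl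
    rw [h2, sub_zero] at h1
    exact h1
  obtain ⟨f, hf⟩ := (convex_ball (φ x₀) r).exists_forall_hasFDerivAt_of_fderiv_symmetric
    Metric.isOpen_ball (fun y hy ↦ ((hθs y (hball hy)).differentiableAt
      (by simp)).differentiableWithinAt) hsymm
  have hfs : ∀ y ∈ B, ContDiffAt ℝ ∞ f y := by
    have h1 : ContDiffOn ℝ ∞ f B := by
      refine (contDiffOn_infty_iff_fderiv_of_isOpen Metric.isOpen_ball).2
        ⟨fun y hy ↦ (hf y hy).differentiableAt.differentiableWithinAt, fun y hy ↦ ?_⟩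
      refine ContDiffWithinAt.congr ((hθs y (hball hy)).contDiffWithinAt)
        (fun z hz ↦ (hf z hz).fderiv) (hf y hy).fderiv
    exact fun y hy ↦ h1.contDiffAt (Metric.isOpen_ball.mem_nhds hy)
  have hβs : ∀ x ∈ φ.source ∩ φ ⁻¹' B, ContMDiffAt 𝓘(ℝ, E) 𝓘(ℝ, ℝ) ∞ (f ∘ φ) x := fun x hx ↦
    (hfs _ hx.2).contMDiffAt.comp x (contMDiffAt_extChartAt' (by simpa [hφ] using hx.1))
  refine ⟨φ.source ∩ φ ⁻¹' B, ?_, ⟨mem_extChartAt_source x₀, Metric.mem_ball_self hr⟩, f ∘ φ,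
    fun x hx ↦ (hβs x hx).contMDiffWithinAt, ?_⟩
  · exact (continuousOn_extChartAt x₀).isOpen_inter_preimage (isOpen_extChartAt_source x₀)
      Metric.isOpen_ball
  · rintro x ⟨hx, hxB⟩ v
    obtain ⟨y, hy, rfl⟩ : ∃ y ∈ φ.target, φ.symm y = x := ⟨φ x, φ.map_source hx, φ.left_inv hx⟩
    obtain ⟨X, hX, rfl⟩ := SmoothField.exists_eq v
    have hyB : y ∈ B := by rwa [Set.mem_preimage, φ.right_inv hy] at hxB
    rw [← fderiv_comp_extChartAt_symm hy ((hβs _ ⟨hx, hxB⟩).mdifferentiableAt (by simp)),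
      ← hθX y hy, ← (hf y hyB).fderiv]
    have h1 : (f ∘ φ) ∘ φ.symm =ᶠ[𝓝 y] f := by
      filter_upwards [(isOpen_extChartAt_target x₀).mem_nhds hy] with z hz
      exact congrArg f (φ.right_inv hz)
    exact congrArg (fun L : E →L[ℝ] ℝ ↦ L (chartField x₀ X y)) h1.fderiv_eq

end Poincare

/-! ### Locally conformal Kähler structures. -/

namespace ConfAlmostHermitian

variable {E : Type*} [NormedAddCommGroup E] [NormedSpace ℝ E] [FiniteDimensional ℝ E]
  {M : Type*} [TopologicalSpace M] [T2Space M] [ChartedSpace E M] [IsManifold 𝓘(ℝ, E) ∞ M]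
  (S : ConfAlmostHermitian E M) (hdim : 4 ≤ Module.finrank ℝ E)
include hdim

/-- From `0 = d(e^α Ω) = e^α (dα ∧ Ω + dΩ)` one reads off `dΩ = -dα ∧ Ω`, and uniqueness of the Lee
form applies. -/
lemma lee_eq_of_isKahlerOn {g : S.Gauge} {α : M → ℝ} {U : Set M}
    (hα : ContMDiffOn 𝓘(ℝ, E) 𝓘(ℝ, ℝ) ∞ α U)
    (hK : IsKahlerOn (fun x ↦ Real.exp (α x) • g.1.inner x) S.J U) {x : M} (hx : x ∈ U) :
    (∀ v, S.lee g x v = -mvfderiv 𝓘(ℝ, E) α x v) ∧ S.dFundForm₀ g x = 0 := by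
  obtain ⟨Ω, hΩ, hclosed⟩ := hK.closed
  have hU := hK.isOpen.mem_nhds hx
  have hαx := hα.contMDiffAt hU
  have hexp : ContMDiffAt 𝓘(ℝ, E) 𝓘(ℝ, ℝ) ∞ (fun y ↦ Real.exp (α y)) x :=
    Real.contDiff_exp.contMDiff.contMDiffAt.comp x hαx
  have h1 := extD_smul_two (S.smoothFormAt_fundForm g x) (Ω' := Ω) hexp (by
    filter_upwards [hU] with y hy
    ext v
    have e : v = ![v 0, v 1] := by ext i; fin_cases i <;> rfl
    rw [e]
    exact hΩ y hy _ _)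
  rw [hclosed x hx] at h1
  have h2 : (extD (S.fundForm g) x).toAlternatingMap =
      wedge (-mvfderiv 𝓘(ℝ, E) α x).toLinearMap (S.fundForm g x).toAlternatingMap := by
    refine alternating_three_ext fun u v w ↦ ?_
    have h3 := congrArg (fun ψ ↦ ψ ![u, v, w]) h1
    simp only [AlternatingMap.add_apply, wedge_apply, AlternatingMap.smul_apply] at h3
    change 0 = mvfderiv 𝓘(ℝ, E) (fun y ↦ Real.exp (α y)) x u * S.fundForm g x ![v, w] -
      mvfderiv 𝓘(ℝ, E) (fun y ↦ Real.exp (α y)) x v * S.fundForm g x ![u, w] +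
      mvfderiv 𝓘(ℝ, E) (fun y ↦ Real.exp (α y)) x w * S.fundForm g x ![u, v] +
      Real.exp (α x) * extD (S.fundForm g) x ![u, v, w] at h3
    rw [wedge_apply]
    change extD (S.fundForm g) x ![u, v, w] =
      -mvfderiv 𝓘(ℝ, E) α x u * S.fundForm g x ![v, w] -
      -mvfderiv 𝓘(ℝ, E) α x v * S.fundForm g x ![u, w] +
      -mvfderiv 𝓘(ℝ, E) α x w * S.fundForm g x ![u, v]
    simp only [mvfderiv_comp_apply (Real.hasDerivAt_exp (α x)) hαx] at h3
    refine mul_left_cancel₀ (Real.exp_pos (α x)).ne' ?_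
    linarith
  obtain ⟨h3, h4⟩ := S.eq_lee_of_extD_eq hdim h2
  refine ⟨fun v ↦ ?_, h4⟩
  rw [← h3]
  rfl

omit hdim in
lemma isKahlerOn_of_mvfderiv_eq (hJ : S.J.Integrable) {g : S.Gauge} {β : M → ℝ} {U : Set M}
    (hU : IsOpen U) (hβ : ContMDiffOn 𝓘(ℝ, E) 𝓘(ℝ, ℝ) ∞ β U)
    (hd : ∀ x ∈ U, ∀ v, mvfderiv 𝓘(ℝ, E) β x v = S.lee g x v)
    (h0 : ∀ x, S.dFundForm₀ g x = 0) :
    IsKahlerOn (fun x ↦ Real.exp (-β x) • g.1.inner x) S.J U where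
  isOpen := hU
  contMDiffOn := by
    have hexp : ContMDiffOn 𝓘(ℝ, E) 𝓘(ℝ, ℝ) ∞ (fun y ↦ Real.exp (-β y)) U :=
      (Real.contDiff_exp.comp contDiff_neg).contMDiff.comp_contMDiffOn hβ
    exact hexp.smul_section g.1.contMDiff.contMDiffOn
  symm x _ u v := congrArg (Real.exp (-β x) * ·) (g.1.symm x u v)
  pos x _ u hu := mul_pos (Real.exp_pos _) (g.1.pos x u hu)
  hermitian x _ u v := congrArg (Real.exp (-β x) * ·) (S.compatible g.1 g.2 x u v)
  integrable X Y hX hY x _ := hJ X Y hX hY x (Set.mem_univ x)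
  closed := by
    -- On `U`, `d(e^{-β} Ω) = e^{-β} (dΩ - ω ∧ Ω) = e^{-β} (dΩ)₀ = 0`.
    refine ⟨fun x ↦ Real.exp (-β x) • S.fundForm g x, fun x _ u v ↦ rfl, fun x hx ↦ ?_⟩
    have hβx := hβ.contMDiffAt (hU.mem_nhds hx)
    have hexp : ContMDiffAt 𝓘(ℝ, E) 𝓘(ℝ, ℝ) ∞ (fun y ↦ Real.exp (-β y)) x :=
      (Real.contDiff_exp.comp contDiff_neg).contMDiff.contMDiffAt.comp x hβx
    have hde : ∀ v, mvfderiv 𝓘(ℝ, E) (fun y ↦ Real.exp (-β y)) x v =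
        Real.exp (-β x) * -1 * S.lee g x v := fun v ↦ by
      rw [← hd x hx, ← mvfderiv_comp_apply (φ := fun a ↦ Real.exp (-a))
        ((hasDerivAt_neg (β x)).exp) hβx]
    refine ContinuousAlternatingMap.toAlternatingMap_injective ?_
    rw [extD_smul_two (S.smoothFormAt_fundForm g x) hexp (Filter.Eventually.of_forall fun _ ↦ rfl)]
    refine alternating_three_ext fun u v w ↦ ?_
    have h1 := S.dFundForm₀_apply g x u v w
    rw [h0 x, AlternatingMap.zero_apply] at h1
    rw [AlternatingMap.add_apply, wedge_apply, AlternatingMap.smul_apply]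
    change mvfderiv 𝓘(ℝ, E) (fun y ↦ Real.exp (-β y)) x u * S.fundForm g x ![v, w] -
      mvfderiv 𝓘(ℝ, E) (fun y ↦ Real.exp (-β y)) x v * S.fundForm g x ![u, w] +
      mvfderiv 𝓘(ℝ, E) (fun y ↦ Real.exp (-β y)) x w * S.fundForm g x ![u, v] +
      Real.exp (-β x) * extD (S.fundForm g) x ![u, v, w] = 0
    rw [hde, hde, hde]
    linear_combination Real.exp (-β x) * -h1

theorem isLocallyConformalKahler_iff (hJ : S.J.Integrable) :
    S.IsLocallyConformalKahler ↔ S.IsFlat ∧ S.OmegaClosed := by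
  rw [S.isFlat_iff hdim, S.omegaClosed_iff]
  constructor
  · rintro ⟨g, hg⟩
    refine ⟨fun X Y hX hY x ↦ ?_, fun x ↦ ?_⟩
    · obtain ⟨U, hxU, α, hα, hK⟩ := hg x
      have hU := hK.isOpen.mem_nhds hxU
      have hαx := hα.contMDiffAt hU
      -- The equality `ω = -dα` holds on a neighbourhood of `x`, so it may be differentiated; then
      -- `dω = -d(dα) = 0`.
      have hl : ∀ V : (y : M) → Tan E y, ∀ v, mvfderiv 𝓘(ℝ, E) (fun y ↦ S.lee g y (V y)) x v =
          -mvfderiv 𝓘(ℝ, E) (fun y ↦ mvfderiv 𝓘(ℝ, E) α y (V y)) x v := by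
        intro V v
        rw [← mvfderiv_neg_apply]
        refine congrArg (fun L : E →L[ℝ] ℝ ↦ L v) (mvfderiv_congr ?_)
        filter_upwards [hU] with y hy
        exact (S.lee_eq_of_isKahlerOn hdim hα hK hy).1 _
      rw [← S.extD_leeForm_eq hdim g hX hY, S.extD_leeForm_apply hdim g hX hY, hl, hl,
        (S.lee_eq_of_isKahlerOn hdim hα hK hxU).1, mvfderiv_bracket hαx hX hY]
      ring
    · obtain ⟨U, hxU, α, hα, hK⟩ := hg x
      exact (S.dFundForm₀_eq_zero_iff hdim g x).1 (S.lee_eq_of_isKahlerOn hdim hα hK hxU).2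
  · rintro ⟨hF, h0⟩
    refine ⟨S.gauge, fun x₀ ↦ ?_⟩
    obtain ⟨U, hU, hx, β, hβ, hd⟩ :=
      exists_mvfderiv_eq (fun x ↦ S.smoothFormAt_leeForm hdim S.gauge x) hF x₀
    exact ⟨U, hx, fun x ↦ -β x, hβ.neg, S.isKahlerOn_of_mvfderiv_eq hJ hU hβ hd h0⟩

end ConfAlmostHermitian

end LCK

end

theorem mainTheorem7 {E : Type*} [NormedAddCommGroup E] [NormedSpace ℝ E] [FiniteDimensional ℝ E]
    {M : Type*} [TopologicalSpace M] [T2Space M] [ChartedSpace E M] [IsManifold 𝓘(ℝ, E) ∞ M]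
    (hdim : 4 ≤ Module.finrank ℝ E) (S : LCK.ConfAlmostHermitian E M) :
    (∀ g : S.Gauge,
      (S.PreservesJ ↔ S.J.Integrable ∧ ∀ x, S.dFundForm₀ g x = 0) ∧
      (∀ X Y : (x : M) → LCK.Tan E x, LCK.SmoothField X → LCK.SmoothField Y →
        ∀ x, S.curvL X Y (g.1.density 2) x =
          LCK.extD (S.leeForm g) x ![X x, Y x] • g.1.density 2 x)) ∧
    (S.J.Integrable → (S.IsLocallyConformalKahler ↔ S.IsFlat ∧ S.OmegaClosed)) := by
  exact ⟨fun g ↦ ⟨S.preservesJ_iff hdim g, fun X Y hX hY x ↦ S.curvL_density hdim g hX hY x⟩,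
    S.isLocallyConformalKahler_iff hdim⟩
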